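/- **Setting.** Let $\xi$ be an $\mathbb R^d$-valued random vector with law $\mathbb P$ that has a Lebesgue density $f_\xi$, where the support of $\mathbb P$ is a closed cone $\mathcal E\subseteq\mathbb R^d$ and $f_\xi=0$ off $\mathcal E$. Let $g_1,\dots,g_K:\mathbb R^m\times\mathbb R^d\to[-\infty,\infty]$ be lower semicontinuous, $\mathcal X\subseteq\mathbb R^m$ a cone ($tx\in\mathcal X$ for $x\in\mathcal X$, $t>0$), and $c:\mathcal X\to\mathbb R$. Write $g=\max_k g_k$, $\mathcal S(x)=\{z\in\mathcal E: g(x,z)\le 0\}$ and $\mathcal X'=\{x\in\mathcal X:\operatorname{int}\mathcal S(x)\ne\emptyset\}$, and assume $\mathcal X'\neq\emptyset$. A set-valued map $S$ is *non-vacuous* if $\mathcal E\setminus S(x)\neq\emptyset$ for all $x\in\mathcal X$ and $\mathcal E\setminus S(x)$ is bounded away from $0$ for all $x\in\mathcal X'$. Let $r>0$ be such that one of the following two models holds. * *(Homogeneous model)* For all $x\in\mathcal X$, $t>1$: $t^rx\in\mathcal X$ and $\mathcal S(t^rx)=t\,\mathcal S(x)$; $\mathcal S$ is continuous on $\mathcal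 X$ (in the sense of Painlevé–Kuratowski) and non-vacuous; and $\mathcal E\setminus\mathcal S(0)\ne\emptyset$. * *(Non-homogeneous model)* $t^rx\in\mathcal X$ for all $x\in\mathcal X$, $t>1$, and there are $\rho\ge0$ and $g^*:\mathbb R^m\times\mathbb R^d\to[-\infty,\infty]$ such that (a) $\liminf_n n^{-\rho}g(n^rx_n,nz_n)\ge g^*(x,z)$ whenever $(x_n,z_n)\to(x,z)$; (b) whenever $x_n\to x$ and $z\in\mathbb R^d$, there are $z_n\to z$ with $\limsup_n n^{-\rho}g(n^rx_n,nz_n)\le g^*(x,z)$; (c) $\mathcal S^*(x)=\{z\in\mathcal E:g^*(x,z)\le0\}$ is non-vacuous and $\mathcal E\setminus\mathcal S^*(0)\neq\emptyset$; (d) for each $x\in\mathcal X'$ the rescaled unsafe sets $n^{-1}(\mathcal E\setminus\mathcal S(n^rx))$ are bounded away from $0$, uniformly for all large $n$. The cost satisfies $c(tx)=tc(x)$ for $x\in\mathcal X$, $t>0$; $t\mapsto c(t^rx)$ is strictly increasing on $(0,\infty)$ for each $x\in\mathcal X'$; and the sublevel sets $\{x\in\mathcal X:c(x)\le a\}$,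 $a\in\mathbb R$, are bounded. A function $\lambda:[0,\infty)\to[0,\infty)$ is in $\mathrm{RV}(\kappa)$ if $\lambda(tx)/\lambda(t)\to x^\kappa$ as $t\to\infty$ for every $x>0$. Assume that $\mathbb P$ satisfies either $(\mathscr L)$: $-\log f_\xi(tz)\sim\varphi^*(z)\lambda(t)$ with $\lambda\in\mathrm{RV}(\gamma)$, or $(\mathscr H)$: $f_\xi(tz)\sim\varphi^*(z)t^{-d}\lambda(t)$ with $\lambda\in\mathrm{RV}(-\gamma)$; in both cases $\gamma>0$, $\varphi^*$ is positive and continuous on $\mathcal E\setminus\{0\}$, and the asymptotics hold as $t\to\infty$, uniformly over $z$ in compact subsets of $\mathcal E$ not containing $0$. Let $f:[0,\infty)\to[0,\infty)$ be continuous and strictly convex with $f(1)=0$ and $f(x)/x\to\infty$ as $x\to\infty$, and let it grow exponentially: there are $a,q>0$ with $f(x)/x\ge \exp(a x^q)$ for all large $x$. Let $\eta\in(0,\infty)$ and let $\mathcal P$ be the set of probability measures $\mathbb Q\ll\mathbb P$ on $\mathbb R^d$ with $E_{\mathbb P}[f(d\mathbb Q/d\mathbb P)]\le\eta$. For $\alpha\in(0,1)$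 let $v^*_\alpha$ be the optimal value (infimum) of $\min_{x\in\mathcal X}c(x)$ subject to $\mathbb P\{g_k(x,\xi)\le0,\ k=1,\dots,K\}\ge1-\alpha$, and let $v^{f}_\alpha$ be the optimal value of $\min_{x\in\mathcal X}c(x)$ subject to $\inf_{\mathbb Q\in\mathcal P}\mathbb Q\{g_k(x,\xi)\le0,\ k=1,\dots,K\}\ge1-\alpha$ (the $f$-divergence DRO problem). **Proposition.** Under either $(\mathscr L)$ or $(\mathscr H)$, any optimal solutions $x^{f}_\alpha$ of the $f$-divergence DRO problem satisfy $\log c(x^{f}_\alpha)\sim\log v^*_\alpha$ as $\alpha\to0^+$, i.e. $\log c(x^{f}_\alpha)/\log v^*_\alpha\to1$; that is, the formulation is weakly scale-preserving. The same holds for the DRO optimal value (whether or not it is attained): $\log v^{f}_\alpha\sim\log v^*_\alpha$. -/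

import Mathlib

open Filter Topology MeasureTheory Set
open scoped Pointwise ENNReal

noncomputable section

namespace ChanceDRO

variable {m d K : ℕ}

/-- The aggregated constraint function `max_{k} g_k(x, z)`, with values in the extended reals. -/
def gmax (g : Fin K → (Fin m → ℝ) → (Fin d → ℝ) → EReal)
    (x : Fin m → ℝ) (z : Fin d → ℝ) : EReal :=
  ⨆ k, g k x z

/-- The safe set `S(x) = {z ∈ E : max_k g_k(x, z) ≤ 0}`. -/
def safeSet (g : Fin K → (Fin m → ℝ) → (Fin d → ℝ) → EReal)
    (E : Set (Fin d → ℝ)) (x : Fin m → ℝ) : Set (Fin d → ℝ) :=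
  {z | z ∈ E ∧ gmax g x z ≤ 0}

/-- The decisions in `X` whose safe set has a non-empty interior. -/
def regularDecisions (g : Fin K → (Fin m → ℝ) → (Fin d → ℝ) → EReal)
    (E : Set (Fin d → ℝ)) (X : Set (Fin m → ℝ)) : Set (Fin m → ℝ) :=
  {x | x ∈ X ∧ (interior (safeSet g E x)).Nonempty}

/-- A set-valued map `S` is non-vacuous for the support `E` and the decision set `X` (`X'` being
the set of regular decisions): the unsafe sets `E \ S(x)`, `x ∈ X`, are non-empty, and those with
`x ∈ X'` are bounded away from the origin. -/
def NonVacuous (S : (Fin m → ℝ) → Set (Fin d → ℝ)) (E : Set (Fin d → ℝ))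
    (X X' : Set (Fin m → ℝ)) : Prop :=
  (∀ x ∈ X, (E \ S x).Nonempty) ∧
    ∀ x ∈ X', ∃ ε > 0, ∀ z ∈ E \ S x, ε ≤ ‖z‖

/-- Continuity, in the sense of Painlevé and Kuratowski, of a set-valued map relative to `X`:
at each `x ∈ X`, the outer limit of `S(y)` as `y → x` in `X` is contained in `S(x)`, and `S(x)` is
contained in the inner limit. -/
def SetValuedContinuousOn (S : (Fin m → ℝ) → Set (Fin d → ℝ)) (X : Set (Fin m → ℝ)) : Prop :=
  ∀ x ∈ X,
    (∀ z, (∀ U ∈ 𝓝 z, ∃ᶠ y in 𝓝[X] x, (S y ∩ U).Nonempty) → z ∈ S x) ∧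
    (∀ z ∈ S x, ∀ U ∈ 𝓝 z, ∀ᶠ y in 𝓝[X] x, (S y ∩ U).Nonempty)

/-- `C` is a cone: it is stable under multiplication by positive scalars. -/
def IsConeSet {n : ℕ} (C : Set (Fin n → ℝ)) : Prop :=
  ∀ x ∈ C, ∀ t : ℝ, 0 < t → t • x ∈ C

/-- The homogeneous safe-set model with scaling exponent `r`. -/
structure HomogeneousModel (g : Fin K → (Fin m → ℝ) → (Fin d → ℝ) → EReal)
    (E : Set (Fin d → ℝ)) (X : Set (Fin m → ℝ)) (r : ℝ) : Prop where
  scaling : ∀ x ∈ X, ∀ t : ℝ, 1 < t →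
    t ^ r • x ∈ X ∧ safeSet g E (t ^ r • x) = t • safeSet g E x
  continuous : SetValuedContinuousOn (safeSet g E) X
  nonVacuous : NonVacuous (safeSet g E) E X (regularDecisions g E X)
  /-- the null decision `x = 0` (whether or not it lies in `X`) is not safe in every scenario -/
  origin_unsafe : (E \ safeSet g E 0).Nonempty

/-- The limiting safe set `S*(x) = {z ∈ E : g*(x, z) ≤ 0}`. -/
def limitSafeSet (gs : (Fin m → ℝ) → (Fin d → ℝ) → EReal) (E : Set (Fin d → ℝ))
    (x : Fin m → ℝ) : Set (Fin d → ℝ) :=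
  {z | z ∈ E ∧ gs x z ≤ 0}

/-- The rescaled constraint function `n ^ (-ρ) * max_k g_k(n ^ r x, n z)`. -/
def scaledG (g : Fin K → (Fin m → ℝ) → (Fin d → ℝ) → EReal) (r ρ : ℝ) (n : ℕ)
    (x : Fin m → ℝ) (z : Fin d → ℝ) : EReal :=
  gmax g ((n : ℝ) ^ r • x) ((n : ℝ) • z) / (((n : ℝ) ^ ρ : ℝ) : EReal)

/-- The non-homogeneous safe-set model with exponents `r`, `ρ` and limiting constraint `gs`. -/
structure AsymptoticModelWith (g : Fin K → (Fin m → ℝ) → (Fin d → ℝ) → EReal)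
    (E : Set (Fin d → ℝ)) (X : Set (Fin m → ℝ)) (r ρ : ℝ)
    (gs : (Fin m → ℝ) → (Fin d → ℝ) → EReal) : Prop where
  rho_nonneg : 0 ≤ ρ
  scaling : ∀ x ∈ X, ∀ t : ℝ, 1 < t → t ^ r • x ∈ X
  liminf_le : ∀ (xs : ℕ → Fin m → ℝ) (zs : ℕ → Fin d → ℝ) (x : Fin m → ℝ) (z : Fin d → ℝ),
    Tendsto xs atTop (𝓝 x) → Tendsto zs atTop (𝓝 z) →
      gs x z ≤ liminf (fun n => scaledG g r ρ n (xs n) (zs n)) atTop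
  le_limsup : ∀ (xs : ℕ → Fin m → ℝ) (x : Fin m → ℝ) (z : Fin d → ℝ),
    Tendsto xs atTop (𝓝 x) →
      ∃ zs : ℕ → Fin d → ℝ, Tendsto zs atTop (𝓝 z) ∧
        limsup (fun n => scaledG g r ρ n (xs n) (zs n)) atTop ≤ gs x z
  nonVacuous : NonVacuous (limitSafeSet gs E) E X (regularDecisions g E X)
  /-- the null decision `x = 0` (whether or not it lies in `X`) is not safe in the limit -/
  origin_unsafe : (E \ limitSafeSet gs E 0).Nonempty
  /-- for a regular decision, not only the limiting unsafe set but also the rescaled unsafe sets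
  `n⁻¹ (E \ S(n ^ r x))` eventually stay away from the origin -/
  scaled_unsafe_away : ∀ x ∈ regularDecisions g E X, ∃ ε > 0, ∀ᶠ n : ℕ in atTop,
    ∀ z ∈ E, (n : ℝ) • z ∉ safeSet g E ((n : ℝ) ^ r • x) → ε ≤ ‖z‖

/-- The non-homogeneous safe-set model with scaling exponent `r`. -/
def AsymptoticModel (g : Fin K → (Fin m → ℝ) → (Fin d → ℝ) → EReal)
    (E : Set (Fin d → ℝ)) (X : Set (Fin m → ℝ)) (r : ℝ) : Prop :=
  ∃ (ρ : ℝ) (gs : (Fin m → ℝ) → (Fin d → ℝ) → EReal), AsymptoticModelWith g E X r ρ gs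

/-- The assumption on the cost function: positive homogeneity, strict monotonicity along regular
rays, and bounded sublevel sets. -/
structure CostAssumption (c : (Fin m → ℝ) → ℝ) (X X' : Set (Fin m → ℝ)) (r : ℝ) : Prop where
  homogeneous : ∀ x ∈ X, ∀ t : ℝ, 0 < t → c (t • x) = t * c x
  strictMono : ∀ x ∈ X', StrictMonoOn (fun t : ℝ => c (t ^ r • x)) (Ioi 0)
  levelBounded : ∀ a : ℝ, Bornology.IsBounded {x | x ∈ X ∧ c x ≤ a}

/-- A function `l : [0, ∞) → [0, ∞)` that is regularly varying at infinity with index `κ`. -/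
def RegularlyVarying (l : ℝ → ℝ) (κ : ℝ) : Prop :=
  (∀ t, 0 ≤ t → 0 ≤ l t) ∧
    ∀ x : ℝ, 0 < x → Tendsto (fun t => l (t * x) / l t) atTop (𝓝 (x ^ κ))

/-- The probability measure `P` has the Lebesgue density `p`, which vanishes off the closed cone
`E`, and `E` is the support of `P`. -/
structure HasDensitySupportedOn (P : Measure (Fin d → ℝ)) (p : (Fin d → ℝ) → ℝ)
    (E : Set (Fin d → ℝ)) : Prop where
  closed : IsClosed E
  cone : IsConeSet E
  measurable : Measurable p
  nonneg : ∀ z, 0 ≤ p z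
  eq_zero : ∀ z, z ∉ E → p z = 0
  density : P = (volume : Measure (Fin d → ℝ)).withDensity (fun z => ENNReal.ofReal (p z))
  support : P.support = E

/-- Lighter-tailed densities: `-log p(t z) ~ φ(z) l(t)` as `t → ∞`, uniformly over `z` in compact
subsets of `E` not containing the origin, with `l` regularly varying of positive index. -/
def LightTailed (p : (Fin d → ℝ) → ℝ) (E : Set (Fin d → ℝ)) : Prop :=
  ∃ (φ : (Fin d → ℝ) → ℝ) (l : ℝ → ℝ) (γ : ℝ), 0 < γ ∧ RegularlyVarying l γ ∧
    (∀ z ∈ E \ {0}, 0 < φ z) ∧ ContinuousOn φ (E \ {0}) ∧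
    ∀ C : Set (Fin d → ℝ), IsCompact C → C ⊆ E → (0 : Fin d → ℝ) ∉ C →
      TendstoUniformlyOn (fun (t : ℝ) z => -Real.log (p (t • z)) / (φ z * l t))
        (fun _ => 1) atTop C

/-- Heavier-tailed densities: `p(t z) ~ φ(z) t ^ (-d) l(t)` as `t → ∞`, uniformly over `z` in
compact subsets of `E` not containing the origin, with `l` regularly varying of negative index. -/
def HeavyTailed (p : (Fin d → ℝ) → ℝ) (E : Set (Fin d → ℝ)) : Prop :=
  ∃ (φ : (Fin d → ℝ) → ℝ) (l : ℝ → ℝ) (γ : ℝ), 0 < γ ∧ RegularlyVarying l (-γ) ∧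
    (∀ z ∈ E \ {0}, 0 < φ z) ∧ ContinuousOn φ (E \ {0}) ∧
    ∀ C : Set (Fin d → ℝ), IsCompact C → C ⊆ E → (0 : Fin d → ℝ) ∉ C →
      TendstoUniformlyOn (fun (t : ℝ) z => p (t • z) / (φ z * (l t / t ^ d)))
        (fun _ => 1) atTop C

/-- The assumption on the function `f : [0, ∞) → [0, ∞)` that defines the `f`-divergence. -/
structure DivergenceFunction (f : ℝ → ℝ) : Prop where
  continuousOn : ContinuousOn f (Ici 0)
  strictConvexOn : StrictConvexOn ℝ (Ici 0) f
  superlinear : Tendsto (fun x => f x / x) atTop atTop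
  nonneg : ∀ x, 0 ≤ x → 0 ≤ f x
  one : f 1 = 0

/-- `f(x) / x` grows (at least) exponentially, possibly at a stretched exponential rate. -/
def ExponentiallyGrowing (f : ℝ → ℝ) : Prop :=
  ∃ a > 0, ∃ q > 0, ∀ᶠ x : ℝ in atTop, Real.exp (a * x ^ q) ≤ f x / x

open Classical in
/-- The `f`-divergence `D_f(Q ‖ P) = E_P[f(dQ/dP)]`, infinite unless `Q ≪ P`. -/
def fDivergence (f : ℝ → ℝ) (Q P : Measure (Fin d → ℝ)) : ℝ≥0∞ :=
  if Q ≪ P then ∫⁻ z, ENNReal.ofReal (f (Q.rnDeriv P z).toReal) ∂P else ∞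

/-- The `f`-divergence ball of radius `η` around `P`. -/
def ambiguitySet (f : ℝ → ℝ) (η : ℝ) (P : Measure (Fin d → ℝ)) : Set (Measure (Fin d → ℝ)) :=
  {Q | IsProbabilityMeasure Q ∧ fDivergence f Q P ≤ ENNReal.ofReal η}

/-- The feasible set of the chance-constrained problem at level `1 - α`. -/
def ccpFeasible (g : Fin K → (Fin m → ℝ) → (Fin d → ℝ) → EReal) (X : Set (Fin m → ℝ))
    (P : Measure (Fin d → ℝ)) (α : ℝ) : Set (Fin m → ℝ) :=
  {x | x ∈ X ∧ ENNReal.ofReal (1 - α) ≤ P {z | ∀ k, g k x z ≤ 0}}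

/-- The feasible set of the distributionally robust chance-constrained problem at level `1 - α`
with the ambiguity set `A`. -/
def droFeasible (g : Fin K → (Fin m → ℝ) → (Fin d → ℝ) → EReal) (X : Set (Fin m → ℝ))
    (A : Set (Measure (Fin d → ℝ))) (α : ℝ) : Set (Fin m → ℝ) :=
  {x | x ∈ X ∧ ENNReal.ofReal (1 - α) ≤ ⨅ Q ∈ A, Q {z | ∀ k, g k x z ≤ 0}}

/-- The optimal value of minimizing the cost `c` over the feasible set `A`. -/
def optimalValue (c : (Fin m → ℝ) → ℝ) (A : Set (Fin m → ℝ)) : ℝ :=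
  sInf (c '' A)

/-- `x` is an optimal solution of minimizing the cost `c` over the feasible set `A`. -/
def IsOptimalSolution (c : (Fin m → ℝ) → ℝ) (A : Set (Fin m → ℝ)) (x : Fin m → ℝ) : Prop :=
  x ∈ A ∧ ∀ y ∈ A, c x ≤ c y

end ChanceDRO

end

/-!
On a logarithmic scale the optimal value depends on the risk level `α` only through the tail rate
of `ξ`. Write `N α` for `-log α` (light tails) or `α⁻¹` (heavy tails), and let `γ` be the tail
index. Two estimates hold for every small change of the exponents.

* A regular decision `x₀`, scaled by `n ^ r`, is unsafe only at distance at least `n ε` from the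
  origin (`norm_ge_of_violated`), which has probability at most `α` as soon as `n ^ s ≥ N α` with
  `s < γ` (`HasTailRate.measure_norm_ge_mul_le`). So the value is at most of the order
  `N α ^ (r / s)`.
* Decisions of cost at most `a n ^ r` are, after scaling, close to the null decision, and hence
  unsafe on `n • C` for a fixed compact `C` of positive volume (`exists_compact_violated`), which
  has probability more than `α` if `n ^ s ≤ N α` with `s > γ`
  (`HasTailRate.rate_lt_measure_smul`). So the value is at least of the order `N α ^ (r / s)`.

Hence `log v_α / log (N α) → r / γ`. The robust problem at level `α` lies between the nominal
problems at the levels `α` and `α ^ (1 + ε)`: the first because `P` belongs to the divergence ball,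
the second because the exponential growth of `f` makes the part of a likelihood ratio above
`α ^ (-ε) / 2` negligible compared with `α` (`eventually_measure_le_of_mem_ambiguitySet`). Passing
from `α` to `α ^ (1 + ε)` multiplies `log (N α)` by at most `1 + ε`, so both logarithms of values
have the same asymptotics (`tendsto_log_optimalValue_div`).

The regularly varying function of the tail hypotheses need not be measurable. The local bounds that
measurability would give come from the uniformity of the density asymptotics along a ray
(`UniformScaling.locally_bounded`).
-/

open Filter Topology MeasureTheory Set
open scoped Pointwise ENNReal

namespace ChanceDRO

/-! ### Regular variation -/

section

theorem eventually_const_mul_rpow_le (K : ℝ) {a b : ℝ} (hab : a < b) :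
    ∀ᶠ t : ℝ in atTop, K * t ^ a ≤ t ^ b := by
  filter_upwards [(tendsto_rpow_atTop (sub_pos.2 hab)).eventually_ge_atTop K,
    eventually_gt_atTop 0] with t ht h0
  calc K * t ^ a ≤ t ^ (b - a) * t ^ a := by gcongr
    _ = t ^ b := by rw [← Real.rpow_add h0]; congr 1; ring

/-- A function that does not increase under doubling is bounded on `[T, ∞)` by its bound on one
period `[T, 2T]`. -/
theorem le_of_doubling {h : ℝ → ℝ} {T M : ℝ} (hT : 0 < T) (hd : ∀ t, T ≤ t → h (2 * t) ≤ h t)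
    (hM : ∀ t ∈ Icc T (2 * T), h t ≤ M) {t : ℝ} (ht : T ≤ t) : h t ≤ M := by
  have key : ∀ n : ℕ, ∀ t ∈ Icc T (2 ^ n * (2 * T)), h t ≤ M := by
    intro n
    induction n with
    | zero => simpa using hM
    | succ n ih =>
      rintro t ⟨h1, h2⟩
      rcases le_total t (2 * T) with h3 | h3
      · exact hM t ⟨h1, h3⟩
      · have h4 := ih (t / 2) ⟨by linarith, by rw [pow_succ] at h2; linarith⟩
        have h5 := hd (t / 2) (by linarith)
        rw [mul_div_cancel₀ t two_ne_zero] at h5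
        exact h5.trans h4
  obtain ⟨n, hn⟩ := pow_unbounded_of_one_lt (t / (2 * T)) (one_lt_two : (1 : ℝ) < 2)
  exact key n t ⟨ht, ((div_lt_iff₀ (by positivity)).1 hn).le⟩

/-- An upper Potter bound, obtained from local boundedness and the behaviour under doubling
only. -/
theorem eventually_le_rpow_of_doubling {l : ℝ → ℝ} {κ s : ℝ}
    (hpos : ∀ᶠ t in atTop, 0 < l t)
    (hlim : Tendsto (fun t => l (t * 2) / l t) atTop (𝓝 (2 ^ κ)))
    (hloc : ∀ᶠ T in atTop, ∃ M, ∀ t ∈ Icc T (2 * T), l t ≤ M) (hs : κ < s) :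
    ∀ᶠ t in atTop, l t ≤ t ^ s := by
  obtain ⟨s', h1, h2⟩ := exists_between hs
  have hlt : (2 : ℝ) ^ κ < 2 ^ s' := Real.rpow_lt_rpow_of_exponent_lt one_lt_two h1
  obtain ⟨T₀, hT₀⟩ := eventually_atTop.1 (hpos.and (hlim.eventually_lt_const hlt))
  obtain ⟨T, ⟨M, hM⟩, hT, hTpos⟩ :=
    (hloc.and ((eventually_ge_atTop T₀).and (eventually_gt_atTop 0))).exists
  have hcont : ContinuousOn (fun t : ℝ => t ^ (-s')) (Icc T (2 * T)) := fun t ht =>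
    (Real.continuousAt_rpow_const t _ (Or.inl (hTpos.trans_le ht.1).ne')).continuousWithinAt
  obtain ⟨K, hK⟩ := isCompact_Icc.bddAbove_image hcont
  have hbd : ∀ t, T ≤ t → l t * t ^ (-s') ≤ M * K := by
    intro t ht
    refine le_of_doubling (h := fun t => l t * t ^ (-s')) hTpos ?_ ?_ ht
    · intro t ht
      have ht0 : 0 < t := hTpos.trans_le ht
      obtain ⟨hp, hq⟩ := hT₀ t (hT.trans ht)
      have := (div_lt_iff₀ hp).1 hq
      show l (2 * t) * (2 * t) ^ (-s') ≤ l t * t ^ (-s')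
      rw [Real.mul_rpow two_pos.le ht0.le, mul_comm 2 t]
      calc l (t * 2) * (2 ^ (-s') * t ^ (-s')) ≤ (2 ^ s' * l t) * (2 ^ (-s') * t ^ (-s')) := by
            gcongr
        _ = (2 ^ s' * 2 ^ (-s')) * (l t * t ^ (-s')) := by ring
        _ = l t * t ^ (-s') := by rw [← Real.rpow_add two_pos]; simp
    · intro t ht
      have ht0 : 0 < t := hTpos.trans_le ht.1
      have h3 := hM t ht
      have h4 : t ^ (-s') ≤ K := hK ⟨t, ht, rfl⟩
      have h5 := (hT₀ t (hT.trans ht.1)).1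
      show l t * t ^ (-s') ≤ M * K
      exact mul_le_mul h3 h4 (by positivity) (h5.le.trans h3)
  filter_upwards [eventually_const_mul_rpow_le (M * K) h2, eventually_ge_atTop T] with t h3 h4
  have ht0 : 0 < t := hTpos.trans_le h4
  refine le_trans ?_ h3
  have := hbd t h4
  rwa [Real.rpow_neg ht0.le, ← div_eq_mul_inv, div_le_iff₀ (by positivity)] at this

theorem RegularlyVarying.eventually_pos {l : ℝ → ℝ} {κ : ℝ} (hl : RegularlyVarying l κ) :
    ∀ᶠ t in atTop, 0 < l t := by
  have h := hl.2 1 one_pos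
  rw [Real.one_rpow] at h
  filter_upwards [h.eventually_ne one_ne_zero, eventually_ge_atTop 0] with t h1 h2
  refine lt_of_le_of_ne (hl.1 t h2) fun h3 => h1 ?_
  rw [← h3, div_zero]

variable {d : ℕ}

/-- The asymptotic relation `F(t z) ~ φ(z) l(t)`, uniformly over `z` in compact subsets of `E`
not containing the origin, with `φ` positive and continuous. -/
structure UniformScaling (F φ : (Fin d → ℝ) → ℝ) (l : ℝ → ℝ) (E : Set (Fin d → ℝ)) : Prop where
  pos : ∀ z ∈ E \ {0}, 0 < φ z
  cont : ContinuousOn φ (E \ {0})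
  unif : ∀ C : Set (Fin d → ℝ), IsCompact C → C ⊆ E → (0 : Fin d → ℝ) ∉ C →
    TendstoUniformlyOn (fun (t : ℝ) z => F (t • z) / (φ z * l t)) (fun _ => 1) atTop C

theorem subset_diff_zero {C E : Set (Fin d → ℝ)} (hCE : C ⊆ E) (h0 : (0 : Fin d → ℝ) ∉ C) :
    C ⊆ E \ {0} := fun z hz => ⟨hCE hz, fun h => h0 (by rw [mem_singleton_iff] at h; rwa [← h])⟩

theorem UniformScaling.exists_bounds {F φ : (Fin d → ℝ) → ℝ} {l : ℝ → ℝ} {E C : Set (Fin d → ℝ)}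
    (h : UniformScaling F φ l E) (hpos : ∀ᶠ t in atTop, 0 < l t)
    (hC : IsCompact C) (hCE : C ⊆ E) (h0 : (0 : Fin d → ℝ) ∉ C) :
    ∃ a b : ℝ, 0 < a ∧ 0 < b ∧
      ∀ᶠ t in atTop, ∀ z ∈ C, a * l t ≤ F (t • z) ∧ F (t • z) ≤ b * l t := by
  have hsub := subset_diff_zero hCE h0
  rcases C.eq_empty_or_nonempty with rfl | hne
  · exact ⟨1, 1, one_pos, one_pos, by simp⟩
  obtain ⟨z₁, hz₁, hmin⟩ := hC.exists_isMinOn hne (h.cont.mono hsub)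
  obtain ⟨z₂, hz₂, hmax⟩ := hC.exists_isMaxOn hne (h.cont.mono hsub)
  refine ⟨φ z₁ / 2, 2 * φ z₂, half_pos (h.pos _ (hsub hz₁)),
    mul_pos two_pos (h.pos _ (hsub hz₂)), ?_⟩
  filter_upwards [Metric.tendstoUniformlyOn_iff.1 (h.unif C hC hCE h0) (1 / 2) (by norm_num),
    hpos] with t ht hl z hz
  have h1 := ht z hz
  have h2 : φ z₁ ≤ φ z := hmin hz
  have h3 : φ z ≤ φ z₂ := hmax hz
  have h4 := h.pos z (hsub hz)
  rw [Real.dist_eq, abs_lt] at h1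
  have hden : 0 < φ z * l t := mul_pos h4 hl
  have h5 : F (t • z) = F (t • z) / (φ z * l t) * (φ z * l t) := by
    rw [div_mul_cancel₀ _ hden.ne']
  rw [h5]
  constructor
  · calc φ z₁ / 2 * l t ≤ 1 / 2 * (φ z * l t) := by nlinarith
      _ ≤ _ := mul_le_mul_of_nonneg_right (by linarith [h1.2]) hden.le
  · calc _ ≤ 2 * (φ z * l t) := mul_le_mul_of_nonneg_right (by linarith [h1.1]) hden.le
      _ ≤ 2 * φ z₂ * l t := by nlinarith

/-- Comparing the uniform asymptotics on a segment of a ray with those at its endpoint bounds the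
regularly varying function locally, even if it is not measurable. -/
theorem UniformScaling.locally_bounded {F φ : (Fin d → ℝ) → ℝ} {l : ℝ → ℝ}
    {E : Set (Fin d → ℝ)} (h : UniformScaling F φ l E) (hpos : ∀ᶠ t in atTop, 0 < l t)
    (hE : IsConeSet E) {w : Fin d → ℝ} (hw : w ∈ E) (hw0 : w ≠ 0) :
    ∀ᶠ T in atTop, ∃ A M : ℝ, 0 < A ∧ ∀ t ∈ Icc T (2 * T), A ≤ l t ∧ l t ≤ M := by
  have hC : IsCompact ((fun s : ℝ => s • w) '' Icc 1 2) :=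
    isCompact_Icc.image (by fun_prop)
  obtain ⟨a, b, ha, hb, hab⟩ := h.exists_bounds hpos hC
    (by rintro _ ⟨s, hs, rfl⟩; exact hE w hw s (one_pos.trans_le hs.1))
    (by
      rintro ⟨s, hs, h0⟩
      rcases smul_eq_zero.1 h0 with h0 | h0
      · linarith [hs.1]
      · exact hw0 h0)
  obtain ⟨T₀, hT₀⟩ := eventually_atTop.1 (hab.and hpos)
  filter_upwards [eventually_ge_atTop T₀, eventually_gt_atTop 0] with T hT hT1
  refine ⟨a * l T / b, b * l T / a, by have := (hT₀ T hT).2; positivity, fun t ht => ?_⟩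
  have h1 := (hT₀ t (hT.trans ht.1)).1 w ⟨1, by norm_num, one_smul _ _⟩
  have h2 := (hT₀ T hT).1 ((t / T) • w)
    ⟨t / T, ⟨(one_le_div hT1).2 ht.1, (div_le_iff₀ hT1).2 ht.2⟩, rfl⟩
  rw [smul_smul, mul_div_cancel₀ _ hT1.ne'] at h2
  rw [div_le_iff₀ hb, le_div_iff₀ ha]
  constructor <;> linarith [h1.1, h1.2, h2.1, h2.2]

/-- On compact sets, `F (t z)` is `t ^ κ` up to an arbitrarily small change of the exponent. -/
theorem UniformScaling.rpow_bounds {F φ : (Fin d → ℝ) → ℝ} {l : ℝ → ℝ} {κ : ℝ}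
    {E : Set (Fin d → ℝ)} (h : UniformScaling F φ l E) (hl : RegularlyVarying l κ)
    (hE : IsConeSet E) (hne : ∃ w ∈ E, w ≠ 0) {C : Set (Fin d → ℝ)}
    (hC : IsCompact C) (hCE : C ⊆ E) (h0 : (0 : Fin d → ℝ) ∉ C) :
    (∀ s, κ < s → ∀ᶠ t : ℝ in atTop, ∀ z ∈ C, F (t • z) ≤ t ^ s) ∧
    (∀ s, s < κ → ∀ᶠ t : ℝ in atTop, ∀ z ∈ C, t ^ s ≤ F (t • z)) := by
  obtain ⟨w, hw, hw0⟩ := hne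
  have hpos := hl.eventually_pos
  have hloc := h.locally_bounded hpos hE hw hw0
  obtain ⟨a, b, ha, hb, hab⟩ := h.exists_bounds hpos hC hCE h0
  constructor
  · intro s hs
    obtain ⟨s', h1, h2⟩ := exists_between hs
    have hup := eventually_le_rpow_of_doubling hpos (hl.2 2 two_pos)
      (hloc.mono fun T ⟨A, M, _, hM⟩ => ⟨M, fun t ht => (hM t ht).2⟩) h1
    filter_upwards [hup, hab, eventually_const_mul_rpow_le b h2] with t h3 h4 h5 z hz
    exact (h4 z hz).2.trans ((mul_le_mul_of_nonneg_left h3 hb.le).trans h5)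
  · intro s hs
    obtain ⟨s', h1, h2⟩ := exists_between hs
    have hup := eventually_le_rpow_of_doubling (l := fun t => (l t)⁻¹) (κ := -κ) (s := -s')
      (hpos.mono fun t ht => inv_pos.2 ht)
      (by
        have := (hl.2 2 two_pos).inv₀ (by positivity)
        rw [Real.rpow_neg two_pos.le]
        refine this.congr fun t => ?_
        rw [inv_div, div_eq_mul_inv, div_eq_mul_inv, inv_inv, mul_comm])
      (hloc.mono fun T ⟨A, M, hA, hM⟩ => ⟨A⁻¹, fun t ht => inv_anti₀ hA (hM t ht).1⟩)
      (neg_lt_neg h2)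
    filter_upwards [hup, hab, eventually_const_mul_rpow_le a⁻¹ h1, eventually_gt_atTop 0,
      hpos] with t h3 h4 h5 h6 h7 z hz
    rw [Real.rpow_neg h6.le] at h3
    have h8 : t ^ s' ≤ l t := (inv_le_inv₀ h7 (by positivity)).1 h3
    calc t ^ s = a * (a⁻¹ * t ^ s) := by field_simp
      _ ≤ a * l t := by gcongr; exact h5.trans h8
      _ ≤ _ := (h4 z hz).1

/-! ### Tail rates -/

/-- A scale for tail probabilities: `B y` is a decreasing rate and `N` its inverse near `0`. The
rates `exp (-y)` and `y⁻¹` belong to light and heavy tails; under both, raising a probability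
level to the power `1 + ε` costs at most the power `1 + ε` in `N`. -/
structure TailScale (B N : ℝ → ℝ) : Prop where
  pos : ∀ y, 0 < y → 0 < B y
  decay : ∀ u y, 1 ≤ u → 1 ≤ y → B (u * y) ≤ u⁻¹ * B y
  rate_le : ∀ α ∈ Ioo (0 : ℝ) 1, ∀ y, 0 < y → N α ≤ y → B y ≤ α
  le_rate : ∀ α ∈ Ioo (0 : ℝ) 1, ∀ y, 0 < y → y ≤ N α → α ≤ B y
  tendsto : Tendsto N (𝓝[>] 0) atTop
  rpow_le : ∀ ε : ℝ, 0 < ε → ∀ᶠ α in 𝓝[>] (0 : ℝ), N (α ^ (1 + ε)) ≤ N α ^ (1 + ε)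

theorem tailScale_exp : TailScale (fun y => Real.exp (-y)) (fun α => -Real.log α) where
  pos y _ := Real.exp_pos _
  decay u y hu hy := by
    rw [inv_mul_eq_div, le_div_iff₀ (by linarith)]
    have h1 : u ≤ Real.exp ((u - 1) * y) := by
      have := Real.add_one_le_exp ((u - 1) * y)
      nlinarith
    calc Real.exp (-(u * y)) * u ≤ Real.exp (-(u * y)) * Real.exp ((u - 1) * y) := by gcongr
      _ = Real.exp (-y) := by rw [← Real.exp_add]; congr 1; ring
  rate_le α hα y _ h := by
    rw [← Real.le_log_iff_exp_le hα.1]; linarith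
  le_rate α hα y _ h := by
    rw [← Real.log_le_iff_le_exp hα.1]; linarith
  tendsto := tendsto_neg_atBot_atTop.comp Real.tendsto_log_nhdsGT_zero
  rpow_le ε hε := by
    have h := (tendsto_neg_atBot_atTop.comp Real.tendsto_log_nhdsGT_zero).eventually
      (eventually_const_mul_rpow_le (1 + ε) (show (1 : ℝ) < 1 + ε by linarith))
    filter_upwards [h, self_mem_nhdsWithin] with α h1 h2
    rw [Real.log_rpow h2]
    simp only [Function.comp, Real.rpow_one] at h1
    linarith

theorem tailScale_inv : TailScale (fun y => y⁻¹) (fun α => α⁻¹) where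
  pos y hy := inv_pos.2 hy
  decay u y _ _ := by rw [mul_inv]
  rate_le α hα y hy h := inv_le_of_inv_le₀ hα.1 h
  le_rate α hα y hy h := le_inv_of_le_inv₀ hy h
  tendsto := tendsto_inv_nhdsGT_zero
  rpow_le ε hε := by
    filter_upwards [self_mem_nhdsWithin] with α h2
    rw [Real.inv_rpow (le_of_lt h2)]

/-- A constant factor is absorbed by any increase of the exponent of the rate. -/
theorem TailScale.eventually_const_mul_le {B N : ℝ → ℝ} (hB : TailScale B N) (K : ℝ) {s s' : ℝ}
    (hs : 0 < s) (h : s < s') : ∀ᶠ t : ℝ in atTop, K * B (t ^ s') ≤ B (t ^ s) := by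
  filter_upwards [eventually_ge_atTop 1,
    (tendsto_rpow_atTop (sub_pos.2 h)).eventually_ge_atTop (max K 1)] with t h1 h2
  have h0 : 0 < t := one_pos.trans_le h1
  have h3 : t ^ s' = t ^ (s' - s) * t ^ s := by rw [← Real.rpow_add h0]; congr 1; ring
  have h4 := hB.decay (t ^ (s' - s)) (t ^ s) ((le_max_right _ _).trans h2)
    (Real.one_le_rpow h1 hs.le)
  have h5 := hB.pos (t ^ s') (by positivity)
  rw [← h3, inv_mul_eq_div, le_div_iff₀ (by positivity)] at h4
  refine le_trans ?_ h4
  rw [mul_comm]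
  gcongr
  exact (le_max_left _ _).trans h2

/-- The density `p`, suitably rescaled, decays at the rate `B (t ^ γ)` up to an arbitrarily small
change of the exponent, uniformly over compact subsets of `E` not containing the origin. -/
def HasTailRate (p : (Fin d → ℝ) → ℝ) (E : Set (Fin d → ℝ)) (B : ℝ → ℝ) (γ : ℝ) : Prop :=
  ∀ C : Set (Fin d → ℝ), IsCompact C → C ⊆ E → (0 : Fin d → ℝ) ∉ C →
    (∀ s, 0 < s → s < γ → ∀ᶠ t : ℝ in atTop, ∀ z ∈ C, t ^ d * p (t • z) ≤ B (t ^ s)) ∧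
    (∀ s, γ < s → ∀ᶠ t : ℝ in atTop, ∀ z ∈ C, B (t ^ s) ≤ t ^ d * p (t • z))

theorem LightTailed.hasTailRate {p : (Fin d → ℝ) → ℝ} {E : Set (Fin d → ℝ)}
    (h : LightTailed p E) (hp : ∀ z, 0 ≤ p z) (hE : IsConeSet E) (hne : ∃ w ∈ E, w ≠ 0) :
    ∃ γ, 0 < γ ∧ HasTailRate p E (fun y => Real.exp (-y)) γ := by
  obtain ⟨φ, l, γ, hγ, hl, h1, h2, h3⟩ := h
  refine ⟨γ, hγ, fun C hC hCE h0 => ?_⟩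
  have hS : UniformScaling (fun z => -Real.log (p z)) φ l E := ⟨h1, h2, h3⟩
  obtain ⟨hup, hlow⟩ := hS.rpow_bounds hl hE hne hC hCE h0
  -- `log 0 = 0` is excluded since `-log p` is eventually positive
  have hppos : ∀ᶠ t : ℝ in atTop, ∀ z ∈ C, 0 < p (t • z) := by
    filter_upwards [hlow (γ / 2) (by linarith), eventually_gt_atTop 0] with t h4 h5 z hz
    refine lt_of_le_of_ne (hp _) fun h6 => ?_
    have := h4 z hz
    simp only [← h6, Real.log_zero, neg_zero] at this
    linarith [Real.rpow_pos_of_pos h5 (γ / 2)]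
  constructor
  · intro s hs hsγ
    obtain ⟨s', h4, h5⟩ := exists_between hsγ
    have hlog : ∀ᶠ t : ℝ in atTop, d * Real.log t ≤ t ^ s := by
      have := (isLittleO_log_rpow_atTop hs).const_mul_left (d : ℝ)
      filter_upwards [this.bound one_pos, eventually_gt_atTop 0] with t h6 h7
      rw [one_mul, Real.norm_eq_abs, Real.norm_eq_abs, abs_of_pos (Real.rpow_pos_of_pos h7 s)] at h6
      exact (le_abs_self _).trans h6
    filter_upwards [hlow s' h5, hppos, hlog, eventually_const_mul_rpow_le 2 h4,
      eventually_gt_atTop 0] with t h6 h7 h8 h9 h10 z hz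
    have h11 := h7 z hz
    rw [← Real.log_le_iff_le_exp (by positivity), Real.log_mul (by positivity) h11.ne',
      Real.log_pow]
    linarith [h6 z hz]
  · intro s hs
    filter_upwards [hup s hs, hppos, eventually_ge_atTop 1] with t h6 h7 h8 z hz
    have h11 := h7 z hz
    have h12 : Real.exp (-t ^ s) ≤ p (t • z) := by
      rw [← Real.le_log_iff_exp_le h11]; linarith [h6 z hz]
    calc Real.exp (-t ^ s) ≤ 1 * p (t • z) := by rwa [one_mul]
      _ ≤ _ := by gcongr; exact one_le_pow₀ h8

theorem HeavyTailed.hasTailRate {p : (Fin d → ℝ) → ℝ} {E : Set (Fin d → ℝ)}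
    (h : HeavyTailed p E) (hE : IsConeSet E) (hne : ∃ w ∈ E, w ≠ 0) :
    ∃ γ, 0 < γ ∧ HasTailRate p E (fun y => y⁻¹) γ := by
  obtain ⟨φ, l, γ, hγ, hl, h1, h2, h3⟩ := h
  refine ⟨γ, hγ, fun C hC hCE h0 => ?_⟩
  -- multiplying by `‖z‖ ^ d` turns `t ^ (-d)` into a part of the scaling function
  have hS : UniformScaling (fun z => ‖z‖ ^ d * p z) (fun z => ‖z‖ ^ d * φ z) l E := by
    refine ⟨fun z hz => ?_,
      (by fun_prop : Continuous fun z : Fin d → ℝ => ‖z‖ ^ d).continuousOn.mul h2,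
      fun C hC hCE h0 => ?_⟩
    · have : 0 < ‖z‖ := norm_pos_iff.2 hz.2
      exact mul_pos (by positivity) (h1 z hz)
    · refine (h3 C hC hCE h0).congr ?_
      filter_upwards [eventually_gt_atTop 0] with t ht z hz
      have : 0 < ‖z‖ := norm_pos_iff.2 (subset_diff_zero hCE h0 hz).2
      simp only [norm_smul, Real.norm_eq_abs, abs_of_pos ht, mul_pow]
      have h5 : 0 < ‖z‖ ^ d := by positivity
      have h6 : 0 < t ^ d := by positivity
      rw [mul_assoc, mul_assoc, ← mul_assoc (‖z‖ ^ d) (φ z), mul_assoc (‖z‖ ^ d) (φ z)]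
      rw [mul_left_comm, mul_div_mul_left _ _ h5.ne', ← mul_div_assoc, div_div_eq_mul_div,
        mul_comm (p _)]
  obtain ⟨hup, hlow⟩ := hS.rpow_bounds hl hE hne hC hCE h0
  obtain ⟨R, hR⟩ := hC.isBounded.exists_norm_le
  obtain ⟨δ, hδ, hδC⟩ : ∃ δ > 0, ∀ z ∈ C, δ ≤ ‖z‖ := by
    have := hC.isClosed.isOpen_compl.mem_nhds h0
    obtain ⟨δ, hδ, h⟩ := Metric.mem_nhds_iff.1 this
    refine ⟨δ, hδ, fun z hz => ?_⟩
    by_contra h4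
    exact h (by simpa using h4) hz
  have hnorm : ∀ t : ℝ, 0 < t → ∀ z, ‖t • z‖ ^ d * p (t • z) = ‖z‖ ^ d * (t ^ d * p (t • z)) := by
    intro t ht z
    rw [norm_smul, Real.norm_eq_abs, abs_of_pos ht, mul_pow]; ring
  constructor
  · intro s hs hsγ
    obtain ⟨s', h4, h5⟩ := exists_between hsγ
    filter_upwards [hup (-s') (neg_lt_neg h5), eventually_gt_atTop 0,
      eventually_const_mul_rpow_le (δ ^ d)⁻¹ (neg_lt_neg h4)] with t h6 h7 h8 z hz
    have h9 := h6 z hz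
    simp only [hnorm t h7] at h9
    have h10 : 0 < δ ^ d := by positivity
    have h11 : δ ^ d ≤ ‖z‖ ^ d := pow_le_pow_left₀ hδ.le (hδC z hz) d
    rw [← Real.rpow_neg h7.le]
    refine le_trans ?_ h8
    rw [inv_mul_eq_div]
    have h12 : 0 < ‖z‖ ^ d := h10.trans_le h11
    calc t ^ d * p (t • z) ≤ t ^ (-s') / ‖z‖ ^ d := by rwa [le_div_iff₀' h12]
      _ ≤ _ := by gcongr
  · intro s hs
    obtain ⟨s', h4, h5⟩ := exists_between hs
    filter_upwards [hlow (-s') (neg_lt_neg h4), eventually_gt_atTop 0,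
      eventually_const_mul_rpow_le ((max R 1) ^ d) (neg_lt_neg h5)] with t h6 h7 h8 z hz
    have h9 := h6 z hz
    simp only [hnorm t h7] at h9
    have h10 : 0 < (max R 1) ^ d := by positivity
    have h11 : ‖z‖ ^ d ≤ (max R 1) ^ d :=
      pow_le_pow_left₀ (norm_nonneg _) ((hR z hz).trans (le_max_left _ _)) d
    have h13 : 0 < ‖z‖ := hδ.trans_le (hδC z hz)
    have h14 : 0 ≤ t ^ d * p (t • z) := by
      have h15 : 0 < ‖z‖ ^ d * (t ^ d * p (t • z)) := (Real.rpow_pos_of_pos h7 _).trans_le h9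
      exact (pos_of_mul_pos_right h15 (by positivity)).le
    rw [← Real.rpow_neg h7.le]
    have h16 := (h8.trans h9).trans (mul_le_mul_of_nonneg_right h11 h14)
    exact le_of_mul_le_mul_left h16 h10

end

/-! ### Tail probabilities -/

section

variable {d : ℕ}

theorem TailScale.anti {B N : ℝ → ℝ} (hB : TailScale B N) {y y' : ℝ} (hy : 1 ≤ y) (h : y ≤ y') :
    B y' ≤ B y := by
  have h0 : 0 < y := one_pos.trans_le hy
  have h1 : 1 ≤ y' / y := (one_le_div h0).2 h
  have h2 := hB.decay (y' / y) y h1 hy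
  rw [div_mul_cancel₀ _ h0.ne'] at h2
  exact h2.trans (mul_le_of_le_one_left (hB.pos y h0).le (inv_le_one_of_one_le₀ h1))

theorem volume_smul_fin (t : ℝ) (ht : 0 ≤ t) (C : Set (Fin d → ℝ)) :
    volume (t • C) = ENNReal.ofReal (t ^ d) * volume C := by
  rw [Measure.addHaar_smul, Module.finrank_fin_fun, abs_of_nonneg (pow_nonneg ht d)]

section Density

variable {P : Measure (Fin d → ℝ)} {p : (Fin d → ℝ) → ℝ} {E C : Set (Fin d → ℝ)}

theorem HasDensitySupportedOn.measure_compl (hp : HasDensitySupportedOn P p E) : P Eᶜ = 0 := by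
  rw [hp.density, withDensity_apply _ hp.closed.measurableSet.compl]
  refine (setLIntegral_congr_fun (g := fun _ => 0) hp.closed.measurableSet.compl
    fun z hz => ?_).trans (by simp)
  simp [hp.eq_zero z hz]

theorem HasDensitySupportedOn.measure_smul_le (hp : HasDensitySupportedOn P p E) {t b : ℝ}
    (ht : 0 < t) (hC : MeasurableSet C) (hb : ∀ z ∈ C, t ^ d * p (t • z) ≤ b) :
    P (t • C) ≤ ENNReal.ofReal b * volume C := by
  have hm : MeasurableSet (t • C) := hC.const_smul₀ t
  rw [hp.density, withDensity_apply _ hm]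
  have h0 : 0 < t ^ d := by positivity
  calc ∫⁻ z in t • C, ENNReal.ofReal (p z) ≤ ∫⁻ _ in t • C, ENNReal.ofReal (b / t ^ d) := by
        refine setLIntegral_mono' hm ?_
        rintro _ ⟨z, hz, rfl⟩
        exact ENNReal.ofReal_le_ofReal ((le_div_iff₀' h0).2 (hb z hz))
    _ = ENNReal.ofReal b * volume C := by
        rw [setLIntegral_const, volume_smul_fin t ht.le, ← mul_assoc,
          ← ENNReal.ofReal_mul' h0.le, div_mul_cancel₀ _ h0.ne']

theorem HasDensitySupportedOn.le_measure_smul (hp : HasDensitySupportedOn P p E) {t b : ℝ}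
    (ht : 0 < t) (hC : MeasurableSet C) (hb : ∀ z ∈ C, b ≤ t ^ d * p (t • z)) :
    ENNReal.ofReal b * volume C ≤ P (t • C) := by
  have hm : MeasurableSet (t • C) := hC.const_smul₀ t
  rw [hp.density, withDensity_apply _ hm]
  have h0 : 0 < t ^ d := by positivity
  calc ENNReal.ofReal b * volume C = ∫⁻ _ in t • C, ENNReal.ofReal (b / t ^ d) := by
        rw [setLIntegral_const, volume_smul_fin t ht.le, ← mul_assoc,
          ← ENNReal.ofReal_mul' h0.le, div_mul_cancel₀ _ h0.ne']
    _ ≤ ∫⁻ z in t • C, ENNReal.ofReal (p z) := by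
        refine setLIntegral_mono' hm ?_
        rintro _ ⟨z, hz, rfl⟩
        exact ENNReal.ofReal_le_ofReal ((div_le_iff₀' h0).2 (hb z hz))

variable {B N : ℝ → ℝ} {γ s : ℝ}

theorem HasTailRate.rate_lt_measure_smul (hT : HasTailRate p E B γ) (hB : TailScale B N)
    (hp : HasDensitySupportedOn P p E) (hγ : 0 < γ) (hC : IsCompact C) (hCE : C ⊆ E)
    (h0 : (0 : Fin d → ℝ) ∉ C) (hvol : volume C ≠ 0) (hs : γ < s) :
    ∀ᶠ t : ℝ in atTop, ENNReal.ofReal (B (t ^ s)) < P (t • C) := by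
  obtain ⟨s', h1, h2⟩ := exists_between hs
  have hfin : volume C ≠ ∞ := hC.measure_lt_top.ne
  have hv : 0 < (volume C).toReal := ENNReal.toReal_pos hvol hfin
  filter_upwards [(hT C hC hCE h0).2 s' h1, eventually_gt_atTop 0,
    hB.eventually_const_mul_le (2 / (volume C).toReal) (hγ.trans h1) h2] with t h3 h4 h5
  refine lt_of_lt_of_le ?_ (hp.le_measure_smul h4 hC.measurableSet h3)
  rw [← ENNReal.ofReal_toReal hfin, ← ENNReal.ofReal_mul' hv.le]
  have h6 : 0 < B (t ^ s) := hB.pos _ (by positivity)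
  rw [div_mul_eq_mul_div, div_le_iff₀ hv] at h5
  exact (ENNReal.ofReal_lt_ofReal_iff (by linarith)).2 (by linarith)

theorem HasTailRate.measure_smul_le_rate (hT : HasTailRate p E B γ) (hB : TailScale B N)
    (hp : HasDensitySupportedOn P p E) (hC : IsCompact C) (hCE : C ⊆ E)
    (h0 : (0 : Fin d → ℝ) ∉ C) (hs : 0 < s) (hsγ : s < γ) :
    ∀ᶠ t : ℝ in atTop, P (t • C) ≤ ENNReal.ofReal (B (t ^ s)) := by
  obtain ⟨s', h1, h2⟩ := exists_between hsγ
  have hfin : volume C ≠ ∞ := hC.measure_lt_top.ne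
  filter_upwards [(hT C hC hCE h0).1 s' (hs.trans h1) h2, eventually_gt_atTop 0,
    hB.eventually_const_mul_le (volume C).toReal hs h1] with t h3 h4 h5
  refine (hp.measure_smul_le h4 hC.measurableSet h3).trans ?_
  rw [← ENNReal.ofReal_toReal hfin, ← ENNReal.ofReal_mul' ENNReal.toReal_nonneg]
  exact ENNReal.ofReal_le_ofReal (by linarith)

theorem exists_mem_dyadic_shell {t : ℝ} (ht : 0 < t) {y : ℝ} (hy : t ≤ y) :
    ∃ k : ℕ, 2 ^ k * t ≤ y ∧ y ≤ 2 * (2 ^ k * t) := by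
  obtain ⟨k, h1, h2⟩ := exists_nat_pow_near ((one_le_div ht).2 hy) (one_lt_two : (1 : ℝ) < 2)
  rw [le_div_iff₀ ht] at h1
  rw [div_lt_iff₀ ht, pow_succ] at h2
  exact ⟨k, h1, by linarith⟩

/-- The tail probability is summed over dyadic shells, on each of which the rate has decayed by a
further constant factor. -/
theorem HasTailRate.measure_norm_ge_le (hT : HasTailRate p E B γ) (hB : TailScale B N)
    (hp : HasDensitySupportedOn P p E) (hs : 0 < s) (hsγ : s < γ) :
    ∀ᶠ t : ℝ in atTop, P {z | t ≤ ‖z‖} ≤ ENNReal.ofReal (B (t ^ s)) := by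
  obtain ⟨s', h1, h2⟩ := exists_between hsγ
  have hs' : 0 < s' := hs.trans h1
  set Sh : Set (Fin d → ℝ) := E ∩ (Metric.closedBall 0 2 ∩ {z | 1 ≤ ‖z‖}) with hSh
  have hc : IsCompact Sh := by
    refine IsCompact.inter_left ?_ hp.closed
    exact (isCompact_closedBall 0 2).inter_right (isClosed_le continuous_const continuous_norm)
  have h0 : (0 : Fin d → ℝ) ∉ Sh := by
    rintro ⟨_, _, h⟩
    simp at h
    linarith
  obtain ⟨T, hT'⟩ := eventually_atTop.1
    (hT.measure_smul_le_rate hB hp hc inter_subset_left h0 hs' h2)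
  set q : ℝ := (2 ^ s')⁻¹ with hq
  have hq0 : 0 ≤ q := by positivity
  have hq1 : q < 1 := inv_lt_one_of_one_lt₀ (Real.one_lt_rpow one_lt_two hs')
  filter_upwards [eventually_ge_atTop T, eventually_ge_atTop 1,
    hB.eventually_const_mul_le (1 - q)⁻¹ hs h1] with t h3 h4 h5
  have ht : 0 < t := one_pos.trans_le h4
  have hsub : {z | t ≤ ‖z‖} ⊆ Eᶜ ∪ ⋃ k : ℕ, ((2 ^ k * t) • Sh) := by
    intro z hz
    by_cases hzE : z ∈ E
    · right
      obtain ⟨k, h6, h7⟩ := exists_mem_dyadic_shell ht hz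
      have h8 : 0 < 2 ^ k * t := by positivity
      refine mem_iUnion.2 ⟨k, (mem_smul_set_iff_inv_smul_mem₀ h8.ne' _ _).2 ⟨?_, ?_, ?_⟩⟩
      · exact hp.cone z hzE _ (inv_pos.2 h8)
      · rw [mem_closedBall_zero_iff, norm_smul, norm_inv, Real.norm_of_nonneg h8.le,
          inv_mul_le_iff₀ h8]
        linarith
      · show 1 ≤ ‖_‖
        rw [norm_smul, norm_inv, Real.norm_of_nonneg h8.le, le_inv_mul_iff₀ h8]
        linarith
    · exact Or.inl hzE
  have hterm : ∀ k : ℕ, P ((2 ^ k * t) • Sh) ≤ ENNReal.ofReal (q ^ k * B (t ^ s')) := by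
    intro k
    have h6 : (1 : ℝ) ≤ 2 ^ k := one_le_pow₀ one_le_two
    refine (hT' (2 ^ k * t) (by nlinarith)).trans (ENNReal.ofReal_le_ofReal ?_)
    have h7 := hB.decay ((2 ^ k : ℝ) ^ s') (t ^ s') (Real.one_le_rpow h6 hs'.le)
      (Real.one_le_rpow h4 hs'.le)
    rw [← Real.mul_rpow (by positivity) ht.le] at h7
    refine h7.trans (le_of_eq ?_)
    rw [hq, inv_pow, ← Real.rpow_natCast, ← Real.rpow_natCast, ← Real.rpow_mul two_pos.le,
      ← Real.rpow_mul two_pos.le, mul_comm s']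
  have hBpos : 0 ≤ B (t ^ s') := (hB.pos _ (by positivity)).le
  calc P {z | t ≤ ‖z‖} ≤ P Eᶜ + P (⋃ k : ℕ, ((2 ^ k * t) • Sh)) :=
        (measure_mono hsub).trans (measure_union_le _ _)
    _ ≤ ∑' k : ℕ, P ((2 ^ k * t) • Sh) := by
        rw [hp.measure_compl, zero_add]; exact measure_iUnion_le _
    _ ≤ ∑' k : ℕ, ENNReal.ofReal (q ^ k * B (t ^ s')) := ENNReal.tsum_le_tsum hterm
    _ = ENNReal.ofReal ((1 - q)⁻¹ * B (t ^ s')) := by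
        rw [← ENNReal.ofReal_tsum_of_nonneg (fun k => by positivity)
          ((summable_geometric_of_lt_one hq0 hq1).mul_right _), tsum_mul_right,
          tsum_geometric_of_lt_one hq0 hq1]
    _ ≤ _ := ENNReal.ofReal_le_ofReal h5

theorem HasTailRate.measure_norm_ge_mul_le (hT : HasTailRate p E B γ) (hB : TailScale B N)
    (hp : HasDensitySupportedOn P p E) (hs : 0 < s) (hsγ : s < γ) {ε : ℝ} (hε : 0 < ε) :
    ∀ᶠ t : ℝ in atTop, P {z | t * ε ≤ ‖z‖} ≤ ENNReal.ofReal (B (t ^ s)) := by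
  obtain ⟨s', h1, h2⟩ := exists_between hsγ
  filter_upwards [(tendsto_id.atTop_mul_const hε).eventually
    (hT.measure_norm_ge_le hB hp (hs.trans h1) h2), eventually_ge_atTop 1,
    eventually_const_mul_rpow_le (ε ^ s')⁻¹ h1] with t h3 h4 h5
  refine le_trans h3 (ENNReal.ofReal_le_ofReal (hB.anti (Real.one_le_rpow h4 hs.le) ?_))
  simp only [id]
  rw [Real.mul_rpow (by positivity) hε.le]
  rwa [inv_mul_le_iff₀ (by positivity), mul_comm] at h5

/-- Near each point of the support, the support has positive Lebesgue measure. -/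
theorem HasDensitySupportedOn.volume_inter_closedBall_ne_zero (hp : HasDensitySupportedOn P p E)
    {z : Fin d → ℝ} (hz : z ∈ E) {ρ : ℝ} (hρ : 0 < ρ) :
    volume (E ∩ Metric.closedBall z ρ) ≠ 0 := by
  intro h0
  rw [← hp.support] at hz
  have h1 := (Measure.mem_support_iff_forall z).1 hz _ (Metric.closedBall_mem_nhds z hρ)
  have h2 : P (E ∩ Metric.closedBall z ρ) = 0 := by
    have hac : P ≪ volume := by rw [hp.density]; exact withDensity_absolutelyContinuous _ _
    exact hac h0
  have h3 : P (Metric.closedBall z ρ) ≤ P (E ∩ Metric.closedBall z ρ) + P Eᶜ := by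
    refine (measure_mono fun y hy => ?_).trans (measure_union_le _ _)
    by_cases hyE : y ∈ E
    · exact Or.inl ⟨hyE, hy⟩
    · exact Or.inr hyE
  rw [h2, hp.measure_compl, add_zero] at h3
  exact absurd h1 (not_lt.2 h3)

end Density

end

/-! ### Unsafe sets of scaled decisions -/

section

variable {m d K : ℕ} {g : Fin K → (Fin m → ℝ) → (Fin d → ℝ) → EReal}
  {E : Set (Fin d → ℝ)} {X : Set (Fin m → ℝ)} {r : ℝ}

theorem gmax_nonpos_iff {x : Fin m → ℝ} {z : Fin d → ℝ} : gmax g x z ≤ 0 ↔ ∀ k, g k x z ≤ 0 :=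
  iSup_le_iff

theorem mem_safeSet_iff {x : Fin m → ℝ} {z : Fin d → ℝ} (hz : z ∈ E) :
    z ∈ safeSet g E x ↔ gmax g x z ≤ 0 := and_iff_right hz

theorem NonVacuous.exists_ne_zero {S : (Fin m → ℝ) → Set (Fin d → ℝ)} {X' : Set (Fin m → ℝ)}
    (h : NonVacuous S E X X') (hsub : X' ⊆ X) (hne : X'.Nonempty) : ∃ w ∈ E, w ≠ 0 := by
  obtain ⟨x, hx⟩ := hne
  obtain ⟨w, hw⟩ := h.1 x (hsub hx)
  obtain ⟨ε, hε, h2⟩ := h.2 x hx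
  exact ⟨w, hw.1, norm_pos_iff.1 (hε.trans_le (h2 w hw))⟩

theorem exists_ne_zero_of_model (hX' : (regularDecisions g E X).Nonempty)
    (hmodel : HomogeneousModel g E X r ∨ AsymptoticModel g E X r) : ∃ w ∈ E, w ≠ 0 := by
  rcases hmodel with h | ⟨ρ, gs, h⟩
  · exact h.nonVacuous.exists_ne_zero (fun x hx => hx.1) hX'
  · exact h.nonVacuous.exists_ne_zero (fun x hx => hx.1) hX'

/-- Along the ray of a regular decision, the unsafe set recedes linearly from the origin. -/
theorem norm_ge_of_violated (hE : IsConeSet E)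
    (hmodel : HomogeneousModel g E X r ∨ AsymptoticModel g E X r) {x : Fin m → ℝ}
    (hx : x ∈ regularDecisions g E X) :
    ∃ ε > 0, ∀ᶠ n : ℕ in atTop, (n : ℝ) ^ r • x ∈ X ∧
      ∀ z ∈ E, ¬ gmax g ((n : ℝ) ^ r • x) z ≤ 0 → n * ε ≤ ‖z‖ := by
  rcases hmodel with h | ⟨ρ, gs, h⟩
  · obtain ⟨ε, hε, h1⟩ := h.nonVacuous.2 x hx
    refine ⟨ε, hε, ?_⟩
    filter_upwards [eventually_ge_atTop 2] with n hn
    have hn1 : (1 : ℝ) < n := by exact_mod_cast hn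
    have hn0 : (0 : ℝ) < n := one_pos.trans hn1
    obtain ⟨h2, h3⟩ := h.scaling x hx.1 n hn1
    refine ⟨h2, fun z hz hbad => ?_⟩
    rw [← mem_safeSet_iff hz, h3, mem_smul_set_iff_inv_smul_mem₀ hn0.ne'] at hbad
    have h4 := h1 _ ⟨hE z hz _ (inv_pos.2 hn0), hbad⟩
    rwa [norm_smul, norm_inv, Real.norm_of_nonneg hn0.le, le_inv_mul_iff₀ hn0] at h4
  · obtain ⟨ε, hε, h1⟩ := h.scaled_unsafe_away x hx
    refine ⟨ε, hε, ?_⟩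
    filter_upwards [eventually_ge_atTop 2, h1] with n hn h2
    have hn1 : (1 : ℝ) < n := by exact_mod_cast hn
    have hn0 : (0 : ℝ) < n := one_pos.trans hn1
    refine ⟨h.scaling x hx.1 n hn1, fun z hz hbad => ?_⟩
    have h4 := h2 ((n : ℝ)⁻¹ • z) (hE z hz _ (inv_pos.2 hn0)) (by
      rwa [smul_inv_smul₀ hn0.ne', mem_safeSet_iff hz])
    rwa [norm_smul, norm_inv, Real.norm_of_nonneg hn0.le, le_inv_mul_iff₀ hn0] at h4

/-- A convergent sequence indexed along a subsequence is completed by its limit to a convergent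
sequence. -/
theorem tendsto_extend {α : Type*} [TopologicalSpace α] {θ : ℕ → ℕ} (hθ : StrictMono θ)
    {u : ℕ → α} {a : α} (hu : Tendsto u atTop (𝓝 a)) :
    Tendsto (Function.extend θ u fun _ => a) atTop (𝓝 a) := by
  refine fun U hU => ?_
  obtain ⟨J, hJ⟩ := eventually_atTop.1 (hu.eventually hU)
  refine eventually_atTop.2 ⟨θ J, fun n hn => ?_⟩
  by_cases h : ∃ j, θ j = n
  · obtain ⟨j, rfl⟩ := h
    show Function.extend θ u (fun _ => a) (θ j) ∈ U
    rw [hθ.injective.extend_apply]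
    exact hJ j (hθ.le_iff_le.1 hn)
  · show Function.extend θ u (fun _ => a) n ∈ U
    rw [Function.extend_apply' _ _ _ h]
    exact mem_of_mem_nhds hU

theorem scaledG_nonpos {ρ : ℝ} {n : ℕ} {x : Fin m → ℝ} {z : Fin d → ℝ}
    (h : gmax g ((n : ℝ) ^ r • x) ((n : ℝ) • z) ≤ 0) : scaledG g r ρ n x z ≤ 0 := by
  unfold scaledG
  exact EReal.div_nonpos_of_nonpos_of_nonneg h
    (EReal.coe_nonneg.2 (Real.rpow_nonneg (Nat.cast_nonneg n) ρ))

theorem HomogeneousModel.exists_violated_nhds (h : HomogeneousModel g E X r) (hE : IsConeSet E)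
    (hg : ∀ k, LowerSemicontinuous fun p : (Fin m → ℝ) × (Fin d → ℝ) => g k p.1 p.2) :
    ∃ z₀ ∈ E, ∃ δ > 0, ∀ᶠ n : ℕ in atTop, ∀ y ∈ X, ‖y‖ < δ → ∀ z ∈ E, ‖z - z₀‖ < δ →
      ¬ gmax g ((n : ℝ) ^ r • y) ((n : ℝ) • z) ≤ 0 := by
  -- a scenario in which the null decision fails
  obtain ⟨z₀, hz₀, hz₁⟩ := h.4
  rw [mem_safeSet_iff hz₀, gmax_nonpos_iff] at hz₁
  push Not at hz₁
  obtain ⟨k, hk⟩ := hz₁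
  obtain ⟨δ, hδ, hball⟩ := Metric.eventually_nhds_iff.1 (hg k (0, z₀) 0 hk)
  refine ⟨z₀, hz₀, δ, hδ, ?_⟩
  filter_upwards [eventually_ge_atTop 2] with n hn y hy hyδ z hz hzδ hsafe
  have hn1 : (1 : ℝ) < n := by exact_mod_cast hn
  have hn0 : (0 : ℝ) < n := one_pos.trans hn1
  rw [← mem_safeSet_iff (hE z hz n hn0), (h.scaling y hy n hn1).2,
    smul_mem_smul_set_iff₀ hn0.ne', mem_safeSet_iff hz, gmax_nonpos_iff] at hsafe
  have h2 := @hball (y, z) (by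
    rw [Prod.dist_eq, max_lt_iff]
    exact ⟨by simpa using hyδ, by simpa [dist_eq_norm] using hzδ⟩)
  exact absurd (hsafe k) (not_le.2 h2)

/-- A failure along a subsequence of scales would give sequences contradicting the lower epi-limit
inequality at the unsafe scenario of the null decision. -/
theorem AsymptoticModelWith.exists_violated_nhds {ρ : ℝ} {gs : (Fin m → ℝ) → (Fin d → ℝ) → EReal}
    (h : AsymptoticModelWith g E X r ρ gs) :
    ∃ z₀ ∈ E, ∃ δ > 0, ∀ᶠ n : ℕ in atTop, ∀ y ∈ X, ‖y‖ < δ → ∀ z ∈ E, ‖z - z₀‖ < δ →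
      ¬ gmax g ((n : ℝ) ^ r • y) ((n : ℝ) • z) ≤ 0 := by
  -- a scenario in which the null decision fails in the limit
  obtain ⟨z₀, hz₀, hz₁⟩ := h.6
  have hpos : 0 < gs 0 z₀ := not_le.1 fun h1 => hz₁ ⟨hz₀, h1⟩
  refine ⟨z₀, hz₀, ?_⟩
  by_contra! hcon
  have hfreq : ∀ j : ℕ, ∃ᶠ n : ℕ in atTop, ∃ y : Fin m → ℝ, ∃ z : Fin d → ℝ,
      ‖y‖ < 1 / ((j : ℝ) + 1) ∧ ‖z - z₀‖ < 1 / ((j : ℝ) + 1) ∧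
        gmax g ((n : ℝ) ^ r • y) ((n : ℝ) • z) ≤ 0 := by
    intro j
    refine (hcon (1 / ((j : ℝ) + 1)) (by positivity)).mono ?_
    rintro n ⟨y, _, hy, z, _, hz, hyz⟩
    exact ⟨y, z, hy, hz, hyz⟩
  obtain ⟨θ, hθ, hbad⟩ := extraction_forall_of_frequently hfreq
  choose y z hy hz hyz using hbad
  have hy' : Tendsto y atTop (𝓝 0) :=
    squeeze_zero_norm (fun j => (hy j).le) tendsto_one_div_add_atTop_nhds_zero_nat
  have hz' : Tendsto z atTop (𝓝 z₀) := by
    rw [tendsto_iff_norm_sub_tendsto_zero]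
    exact squeeze_zero (fun _ => norm_nonneg _) (fun j => (hz j).le)
      tendsto_one_div_add_atTop_nhds_zero_nat
  have hlim := hpos.trans_le
    (h.liminf_le _ _ 0 z₀ (tendsto_extend hθ hy') (tendsto_extend hθ hz'))
  obtain ⟨j, hj⟩ := (hθ.tendsto_atTop.eventually (eventually_lt_of_lt_liminf hlim)).exists
  rw [hθ.injective.extend_apply, hθ.injective.extend_apply] at hj
  exact absurd (scaledG_nonpos (hyz j)) (not_le.2 hj)

/-- Decisions whose cost is at most a small multiple of `n ^ r` are, after rescaling, close to the
null decision, hence unsafe on the `n`-fold dilation of a fixed compact set of positive volume. -/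
theorem exists_compact_violated {P : Measure (Fin d → ℝ)} {p : (Fin d → ℝ) → ℝ}
    (hp : HasDensitySupportedOn P p E) (hX : IsConeSet X) {X' : Set (Fin m → ℝ)}
    {c : (Fin m → ℝ) → ℝ} (hc : CostAssumption c X X' r) (hne : ∃ w ∈ E, w ≠ 0)
    (hg : ∀ k, LowerSemicontinuous fun p : (Fin m → ℝ) × (Fin d → ℝ) => g k p.1 p.2)
    (hmodel : HomogeneousModel g E X r ∨ AsymptoticModel g E X r) :
    ∃ C : Set (Fin d → ℝ), IsCompact C ∧ C ⊆ E ∧ (0 : Fin d → ℝ) ∉ C ∧ volume C ≠ 0 ∧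
      ∃ a > 0, ∀ᶠ n : ℕ in atTop, ∀ x ∈ X, c x ≤ a * (n : ℝ) ^ r →
        ∀ z ∈ C, ¬ gmax g x ((n : ℝ) • z) ≤ 0 := by
  obtain ⟨z₀, hz₀, δ, hδ, hviol⟩ : ∃ z₀ ∈ E, ∃ δ > 0, ∀ᶠ n : ℕ in atTop, ∀ y ∈ X, ‖y‖ < δ →
      ∀ z ∈ E, ‖z - z₀‖ < δ → ¬ gmax g ((n : ℝ) ^ r • y) ((n : ℝ) • z) ≤ 0 := by
    rcases hmodel with h | ⟨ρ, gs, h⟩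
    · exact h.exists_violated_nhds hp.cone hg
    · exact h.exists_violated_nhds
  -- the unsafe scenario may be the origin, in which case a nearby point of `E` replaces it
  obtain ⟨z₁, hz₁, hz₁0, hz₁δ⟩ : ∃ z₁ ∈ E, z₁ ≠ 0 ∧ ‖z₁ - z₀‖ ≤ δ / 2 := by
    by_cases h0 : z₀ = 0
    · obtain ⟨w, hw, hw0⟩ := hne
      have hw1 : 0 < ‖w‖ := norm_pos_iff.2 hw0
      refine ⟨(δ / (2 * ‖w‖)) • w, hp.cone w hw _ (by positivity),
        smul_ne_zero (by positivity) hw0, ?_⟩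
      rw [h0, sub_zero, norm_smul, Real.norm_of_nonneg (by positivity)]
      apply le_of_eq
      field_simp
    · exact ⟨z₀, hz₀, h0, by simpa using (half_pos hδ).le⟩
  have hz₁n : 0 < ‖z₁‖ := norm_pos_iff.2 hz₁0
  set ρ := min (δ / 4) (‖z₁‖ / 2) with hρ
  have hρ0 : 0 < ρ := lt_min (by positivity) (by positivity)
  obtain ⟨R, hR⟩ := (hc.levelBounded 1).exists_norm_le
  have hR0 : 0 < max R 1 := one_pos.trans_le (le_max_right _ _)
  refine ⟨E ∩ Metric.closedBall z₁ ρ, (isCompact_closedBall _ _).inter_left hp.closed,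
    inter_subset_left, ?_, hp.volume_inter_closedBall_ne_zero hz₁ hρ0, δ / (2 * max R 1),
    by positivity, ?_⟩
  · rintro ⟨_, h⟩
    rw [Metric.mem_closedBall, dist_comm, dist_zero_right] at h
    linarith [min_le_right (δ / 4) (‖z₁‖ / 2)]
  set a := δ / (2 * max R 1) with ha
  have ha0 : 0 < a := by positivity
  filter_upwards [hviol, eventually_ge_atTop 1] with n h1 hn x hx hcx z hz
  have hn0 : (0 : ℝ) < n := by exact_mod_cast hn
  have hnr : 0 < (n : ℝ) ^ r := Real.rpow_pos_of_pos hn0 r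
  have hxy : (n : ℝ) ^ r • (((n : ℝ) ^ r)⁻¹ • x) = x := smul_inv_smul₀ hnr.ne' x
  rw [← hxy]
  refine h1 _ (hX x hx _ (inv_pos.2 hnr)) ?_ z hz.1 ?_
  · have h2 : (a * (n : ℝ) ^ r)⁻¹ • x ∈ {x | x ∈ X ∧ c x ≤ 1} := by
      refine ⟨hX x hx _ (by positivity), ?_⟩
      rw [hc.homogeneous x hx _ (by positivity), inv_mul_le_iff₀ (by positivity), mul_one]
      exact hcx
    have h3 := hR _ h2
    rw [norm_smul, norm_inv, Real.norm_of_nonneg (by positivity),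
      inv_mul_le_iff₀ (by positivity)] at h3
    rw [norm_smul, norm_inv, Real.norm_of_nonneg hnr.le, inv_mul_lt_iff₀ hnr]
    calc ‖x‖ ≤ a * (n : ℝ) ^ r * max R 1 := h3.trans (by gcongr; exact le_max_left _ _)
      _ = (n : ℝ) ^ r * (δ / 2) := by rw [ha]; field_simp
      _ < (n : ℝ) ^ r * δ := by gcongr; linarith
  · have h4 : ‖z - z₁‖ ≤ ρ := by simpa [dist_eq_norm] using hz.2
    calc ‖z - z₀‖ ≤ ‖z - z₁‖ + ‖z₁ - z₀‖ := norm_sub_le_norm_sub_add_norm_sub _ _ _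
      _ < δ := by linarith [min_le_left (δ / 4) (‖z₁‖ / 2)]

theorem CostAssumption.pos {c : (Fin m → ℝ) → ℝ} {X' : Set (Fin m → ℝ)}
    (hc : CostAssumption c X X' r) (hr : 0 < r) {x : Fin m → ℝ} (hx : x ∈ X) (hx' : x ∈ X') :
    0 < c x := by
  have h := hc.strictMono x hx' (mem_Ioi.2 one_pos) (mem_Ioi.2 two_pos) one_lt_two
  simp only [Real.one_rpow, one_smul] at h
  rw [hc.homogeneous x hx _ (by positivity)] at h
  have : (1 : ℝ) < 2 ^ r := Real.one_lt_rpow one_lt_two hr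
  nlinarith

theorem measurableSet_safe
    (hg : ∀ k, LowerSemicontinuous fun p : (Fin m → ℝ) × (Fin d → ℝ) => g k p.1 p.2)
    (x : Fin m → ℝ) : MeasurableSet {z | ∀ k, g k x z ≤ 0} := by
  rw [Set.ofPred_forall]
  refine MeasurableSet.iInter fun k => ?_
  have h : LowerSemicontinuous fun z => g k x z := fun z y hy =>
    (Continuous.prodMk_right x).continuousAt.eventually (hg k (x, z) y hy)
  exact (h.isClosed_preimage 0).measurableSet

end

/-! ### The divergence ball -/

section

variable {m d K : ℕ} {g : Fin K → (Fin m → ℝ) → (Fin d → ℝ) → EReal} {X : Set (Fin m → ℝ)}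
  {P : Measure (Fin d → ℝ)}

/-- `f(x) / x` grows at least like `exp (a x ^ q)` for some real exponent `q > 0`. -/
def StretchedExponentiallyGrowing (f : ℝ → ℝ) : Prop :=
  ∃ a : ℝ, 0 < a ∧ ∃ q : ℝ, 0 < q ∧ ∀ᶠ x : ℝ in atTop, Real.exp (a * x ^ q) ≤ f x / x

/-- The exponent in `ExponentiallyGrowing` ranges over the natural numbers, so this is the case of
an integer exponent; the argument below needs no more than a positive real one. -/
theorem ExponentiallyGrowing.stretched {f : ℝ → ℝ} (h : ExponentiallyGrowing f) :
    StretchedExponentiallyGrowing f := by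
  obtain ⟨a, ha, q, hq, h⟩ := h
  exact ⟨a, ha, q, Nat.cast_pos.2 hq, by simpa only [Real.rpow_natCast] using h⟩

theorem self_mem_ambiguitySet [IsProbabilityMeasure P] {f : ℝ → ℝ} (hf : f 1 = 0) (η : ℝ) :
    P ∈ ambiguitySet f η P := by
  refine ⟨inferInstance, ?_⟩
  rw [fDivergence, if_pos Measure.AbsolutelyContinuous.rfl]
  have h : (fun z => ENNReal.ofReal (f (P.rnDeriv P z).toReal)) =ᵐ[P] fun _ => 0 := by
    filter_upwards [P.rnDeriv_self] with z hz
    simp [hz, hf]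
  simp [lintegral_congr_ae h]

theorem droFeasible_subset_ccpFeasible {A : Set (Measure (Fin d → ℝ))} (hP : P ∈ A) (α : ℝ) :
    droFeasible g X A α ⊆ ccpFeasible g X P α :=
  fun _ hx => ⟨hx.1, hx.2.trans (iInf₂_le P hP)⟩

/-- The likelihood ratio is split at the level `M`: below it `Q` is at most `M P`, and above it the
divergence constraint leaves a mass of at most `κ η`. -/
theorem measure_le_of_mem_ambiguitySet [IsProbabilityMeasure P] {f : ℝ → ℝ} {η M κ : ℝ}
    (hκ : 0 ≤ κ) (hM : 0 ≤ M) (hη : 0 ≤ η) (hfκ : ∀ x, M < x → x ≤ κ * f x)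
    {Q : Measure (Fin d → ℝ)} (hQ : Q ∈ ambiguitySet f η P) (A : Set (Fin d → ℝ)) {b : ℝ}
    (hA : P A ≤ ENNReal.ofReal b) : Q A ≤ ENNReal.ofReal (M * b + κ * η) := by
  obtain ⟨hQp, hdiv⟩ := hQ
  have : IsProbabilityMeasure Q := hQp
  have : SigmaFinite Q := inferInstance
  have : SFinite Q := inferInstance
  have := Measure.haveLebesgueDecomposition_of_sigmaFinite Q P
  rw [fDivergence] at hdiv
  have hac : Q ≪ P := by
    by_contra h
    rw [if_neg h] at hdiv
    exact absurd hdiv (not_le.2 ENNReal.ofReal_lt_top)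
  rw [if_pos hac] at hdiv
  rcases le_or_gt b 0 with hb | hb
  · rw [ENNReal.ofReal_of_nonpos hb, nonpos_iff_eq_zero] at hA
    rw [hac hA]
    exact zero_le
  set F : (Fin d → ℝ) → ℝ≥0∞ := fun z => ENNReal.ofReal (f (Q.rnDeriv P z).toReal)
  have hpt : ∀ᵐ z ∂P, Q.rnDeriv P z ≤ ENNReal.ofReal M + ENNReal.ofReal κ * F z := by
    filter_upwards [Q.rnDeriv_lt_top P] with z hz
    rcases le_or_gt (Q.rnDeriv P z).toReal M with h | h
    · exact ((ENNReal.le_ofReal_iff_toReal_le hz.ne hM).2 h).trans le_self_add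
    · refine le_trans ?_ le_add_self
      rw [← ENNReal.ofReal_mul hκ, ← ENNReal.ofReal_toReal hz.ne]
      exact ENNReal.ofReal_le_ofReal (by simpa using hfκ _ h)
  calc Q A = ∫⁻ z in A, Q.rnDeriv P z ∂P := (Measure.setLIntegral_rnDeriv hac A).symm
    _ ≤ ∫⁻ z in A, (ENNReal.ofReal M + ENNReal.ofReal κ * F z) ∂P :=
        lintegral_mono_ae (ae_restrict_of_ae hpt)
    _ = ENNReal.ofReal M * P A + ENNReal.ofReal κ * ∫⁻ z in A, F z ∂P := by
        rw [lintegral_add_left measurable_const, setLIntegral_const,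
          lintegral_const_mul' _ _ ENNReal.ofReal_ne_top]
    _ ≤ ENNReal.ofReal M * ENNReal.ofReal b + ENNReal.ofReal κ * ENNReal.ofReal η := by
        gcongr
        exact (setLIntegral_le_lintegral _ _).trans hdiv
    _ = ENNReal.ofReal (M * b + κ * η) := by
        rw [ENNReal.ofReal_add (by positivity) (by positivity), ENNReal.ofReal_mul hM,
          ENNReal.ofReal_mul hκ]

/-- For a stretched exponential `f`, the truncation level `M = α ^ (-ε) / 2` makes both parts of the
split likelihood ratio at most `α / 2` on events of probability at most `α ^ (1 + ε)`. -/
theorem eventually_measure_le_of_mem_ambiguitySet [IsProbabilityMeasure P] {f : ℝ → ℝ}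
    (hexp : StretchedExponentiallyGrowing f) {η : ℝ} (hη : 0 < η) {ε : ℝ} (hε : 0 < ε) :
    ∀ᶠ α in 𝓝[>] (0 : ℝ), ∀ Q ∈ ambiguitySet f η P, ∀ A : Set (Fin d → ℝ),
      P A ≤ ENNReal.ofReal (α ^ (1 + ε)) → Q A ≤ ENNReal.ofReal α := by
  obtain ⟨a, ha, q, hq, hgrow⟩ := hexp
  obtain ⟨x₀, hx₀⟩ := eventually_atTop.1 (hgrow.and (eventually_gt_atTop 0))
  have hinv : Tendsto (fun α : ℝ => α⁻¹) (𝓝[>] 0) atTop := tendsto_inv_nhdsGT_zero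
  have hM : ∀ᶠ α in 𝓝[>] (0 : ℝ), 2 * x₀ ≤ (α⁻¹) ^ ε :=
    hinv.eventually ((tendsto_rpow_atTop hε).eventually_ge_atTop (2 * x₀))
  set a' := a * (1 / 2) ^ q with ha'
  have ha'0 : 0 < a' := by positivity
  have hεq : 0 < ε * q := mul_pos hε hq
  have hdecay : ∀ᶠ α in 𝓝[>] (0 : ℝ),
      ((α⁻¹) ^ (ε * q)) ^ (1 / (ε * q)) * Real.exp (-a' * (α⁻¹) ^ (ε * q)) < 1 / (2 * η) :=
    (((tendsto_rpow_mul_exp_neg_mul_atTop_nhds_zero (1 / (ε * q)) a' ha'0).comp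
      (tendsto_rpow_atTop hεq)).comp hinv).eventually_lt_const (by positivity)
  filter_upwards [hM, hdecay, self_mem_nhdsWithin] with α h1 h2 hα Q hQ A hA
  have hα0 : 0 < α := hα
  have hu : 0 < α⁻¹ := inv_pos.2 hα0
  set M := (α⁻¹) ^ ε / 2 with hMdef
  have hM0 : 0 < M := by positivity
  have hMx : x₀ ≤ M := by rw [hMdef]; linarith
  have hMq : a * M ^ q = a' * (α⁻¹) ^ (ε * q) := by
    rw [hMdef, div_eq_mul_one_div, Real.mul_rpow (by positivity) (by norm_num),
      ← Real.rpow_mul hu.le, ha']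
    ring
  refine (measure_le_of_mem_ambiguitySet (Real.exp_pos (-(a * M ^ q))).le hM0.le hη.le ?_ hQ A
    hA).trans (ENNReal.ofReal_le_ofReal ?_)
  · intro x hx
    obtain ⟨h3, h4⟩ := hx₀ x (hMx.trans hx.le)
    rw [le_div_iff₀ h4] at h3
    have h5 : Real.exp (a * M ^ q) ≤ Real.exp (a * x ^ q) := by gcongr
    rw [Real.exp_neg, inv_mul_eq_div, le_div_iff₀ (Real.exp_pos _), mul_comm]
    exact (mul_le_mul_of_nonneg_right h5 h4.le).trans h3
  · rw [← Real.rpow_mul hu.le, mul_one_div_cancel hεq.ne', Real.rpow_one, neg_mul, ← hMq,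
      inv_mul_eq_div, div_lt_div_iff₀ hα0 (by positivity)] at h2
    have h6 : M * α ^ (1 + ε) = α / 2 := by
      rw [hMdef, Real.inv_rpow hα0.le, Real.rpow_add hα0, Real.rpow_one]
      have : 0 < α ^ ε := by positivity
      field_simp
    rw [h6]
    linarith

theorem le_measure_safe_iff [IsProbabilityMeasure P]
    (hg : ∀ k, LowerSemicontinuous fun p : (Fin m → ℝ) × (Fin d → ℝ) => g k p.1 p.2) {α : ℝ}
    (hα : α ∈ Ioo (0 : ℝ) 1) {x : Fin m → ℝ} :
    ENNReal.ofReal (1 - α) ≤ P {z | ∀ k, g k x z ≤ 0} ↔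
      P {z | ∀ k, g k x z ≤ 0}ᶜ ≤ ENNReal.ofReal α := by
  rw [prob_compl_eq_one_sub (measurableSet_safe hg x), ENNReal.ofReal_sub _ hα.1.le,
    ENNReal.ofReal_one, tsub_le_iff_left, tsub_le_iff_right]

/-- The robust problem at level `α` is implied by the nominal one at level `α ^ (1 + ε)`. -/
theorem eventually_ccpFeasible_subset_droFeasible [IsProbabilityMeasure P]
    (hg : ∀ k, LowerSemicontinuous fun p : (Fin m → ℝ) × (Fin d → ℝ) => g k p.1 p.2)
    {f : ℝ → ℝ} (hexp : StretchedExponentiallyGrowing f) {η : ℝ} (hη : 0 < η) {ε : ℝ} (hε : 0 < ε) :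
    ∀ᶠ α in 𝓝[>] (0 : ℝ), ccpFeasible g X P (α ^ (1 + ε)) ⊆
      droFeasible g X (ambiguitySet f η P) α := by
  filter_upwards [eventually_measure_le_of_mem_ambiguitySet (P := P) hexp hη hε,
    Ioo_mem_nhdsGT (zero_lt_one' ℝ)] with α h1 hα x hx
  have hα' : α ^ (1 + ε) ∈ Ioo (0 : ℝ) 1 :=
    ⟨Real.rpow_pos_of_pos hα.1 _, Real.rpow_lt_one hα.1.le hα.2 (by linarith)⟩
  refine ⟨hx.1, le_iInf₂ fun Q hQ => ?_⟩
  have : IsProbabilityMeasure Q := hQ.1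
  rw [le_measure_safe_iff hg hα]
  exact h1 Q hQ _ ((le_measure_safe_iff hg hα').1 hx.2)

end

/-! ### Asymptotics of the optimal values -/

section

variable {m d K : ℕ} {g : Fin K → (Fin m → ℝ) → (Fin d → ℝ) → EReal}
  {E : Set (Fin d → ℝ)} {X : Set (Fin m → ℝ)} {r : ℝ}
  {P : Measure (Fin d → ℝ)} {p : (Fin d → ℝ) → ℝ} {B N : ℝ → ℝ} {γ s : ℝ}
  {c : (Fin m → ℝ) → ℝ}

/-- The upper bound on the cost, attained on the ray of a regular decision. -/
theorem exists_ccpFeasible_cost_le [IsProbabilityMeasure P]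
    (hg : ∀ k, LowerSemicontinuous fun p : (Fin m → ℝ) × (Fin d → ℝ) => g k p.1 p.2)
    (hX' : (regularDecisions g E X).Nonempty) (hr : 0 < r)
    (hmodel : HomogeneousModel g E X r ∨ AsymptoticModel g E X r)
    (hc : CostAssumption c X (regularDecisions g E X) r) (hp : HasDensitySupportedOn P p E)
    (hB : TailScale B N) (hT : HasTailRate p E B γ) (hs : 0 < s) (hsγ : s < γ) :
    ∃ D > 0, ∀ᶠ α in 𝓝[>] (0 : ℝ), ∃ x ∈ ccpFeasible g X P α, c x ≤ D * N α ^ (r / s) := by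
  obtain ⟨x₀, hx₀⟩ := hX'
  obtain ⟨ε, hε, hev⟩ := norm_ge_of_violated hp.cone hmodel hx₀
  have hc₀ := hc.pos hr hx₀.1 hx₀
  refine ⟨2 ^ r * c x₀, by positivity, ?_⟩
  have hNs : Tendsto (fun α => N α ^ (1 / s)) (𝓝[>] 0) atTop :=
    (tendsto_rpow_atTop (by positivity)).comp hB.tendsto
  -- the least scale `n` with `N α ≤ n ^ s`
  have hn : Tendsto (fun α => ⌈N α ^ (1 / s)⌉₊) (𝓝[>] 0) atTop :=
    tendsto_nat_ceil_atTop.comp hNs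
  have hmeas := tendsto_natCast_atTop_atTop.eventually
    (hT.measure_norm_ge_mul_le hB hp hs hsγ hε)
  filter_upwards [hn.eventually hev, hn.eventually hmeas, hNs.eventually_ge_atTop 1,
    hB.tendsto.eventually_gt_atTop 0, Ioo_mem_nhdsGT (zero_lt_one' ℝ)] with α h1 h2 h3 h4 hα
  set n := ⌈N α ^ (1 / s)⌉₊
  have hle : N α ^ (1 / s) ≤ n := Nat.le_ceil _
  have hn0 : (0 : ℝ) < n := by linarith
  refine ⟨(n : ℝ) ^ r • x₀, ⟨h1.1, (le_measure_safe_iff hg hα).2 ?_⟩, ?_⟩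
  · have hsub : {z | ∀ k, g k ((n : ℝ) ^ r • x₀) z ≤ 0}ᶜ ⊆ Eᶜ ∪ {z | n * ε ≤ ‖z‖} := by
      intro z hz
      by_cases hzE : z ∈ E
      · exact Or.inr (h1.2 z hzE fun h => hz (gmax_nonpos_iff.1 h))
      · exact Or.inl hzE
    refine (measure_mono hsub).trans ((measure_union_le _ _).trans ?_)
    rw [hp.measure_compl, zero_add]
    refine h2.trans (ENNReal.ofReal_le_ofReal (hB.rate_le α hα _ (by positivity) ?_))
    calc N α = (N α ^ (1 / s)) ^ s := by
          rw [← Real.rpow_mul h4.le, one_div_mul_cancel hs.ne', Real.rpow_one]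
      _ ≤ (n : ℝ) ^ s := by gcongr
  · rw [hc.homogeneous _ hx₀.1 _ (by positivity)]
    have h5 : (n : ℝ) ≤ 2 * N α ^ (1 / s) := by
      have := Nat.ceil_lt_add_one (show 0 ≤ N α ^ (1 / s) by linarith)
      linarith
    have h6 : (n : ℝ) ^ r ≤ 2 ^ r * N α ^ (r / s) := by
      calc (n : ℝ) ^ r ≤ (2 * N α ^ (1 / s)) ^ r := by gcongr
        _ = 2 ^ r * N α ^ (r / s) := by
          rw [Real.mul_rpow two_pos.le (by positivity), ← Real.rpow_mul h4.le,
            one_div_mul_eq_div]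
    nlinarith

/-- The lower bound on the cost: cheaper decisions are unsafe on a dilated compact set whose
probability exceeds `α`. -/
theorem le_cost_of_mem_ccpFeasible [IsProbabilityMeasure P]
    (hg : ∀ k, LowerSemicontinuous fun p : (Fin m → ℝ) × (Fin d → ℝ) => g k p.1 p.2)
    (hX : IsConeSet X) (hX' : (regularDecisions g E X).Nonempty) (hr : 0 < r)
    (hmodel : HomogeneousModel g E X r ∨ AsymptoticModel g E X r)
    (hc : CostAssumption c X (regularDecisions g E X) r) (hp : HasDensitySupportedOn P p E)
    (hB : TailScale B N) (hγ : 0 < γ) (hT : HasTailRate p E B γ) (hsγ : γ < s) :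
    ∃ D > 0, ∀ᶠ α in 𝓝[>] (0 : ℝ), ∀ x ∈ ccpFeasible g X P α, D * N α ^ (r / s) ≤ c x := by
  obtain ⟨C, hC, hCE, h0, hvol, a, ha, hev⟩ := exists_compact_violated hp hX hc
    (exists_ne_zero_of_model hX' hmodel) hg hmodel
  have hs : 0 < s := hγ.trans hsγ
  refine ⟨a * (1 / 2) ^ r, by positivity, ?_⟩
  have hNs : Tendsto (fun α => N α ^ (1 / s)) (𝓝[>] 0) atTop :=
    (tendsto_rpow_atTop (by positivity)).comp hB.tendsto
  -- the greatest scale `n` with `n ^ s ≤ N α`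
  have hn : Tendsto (fun α => ⌊N α ^ (1 / s)⌋₊) (𝓝[>] 0) atTop :=
    tendsto_nat_floor_atTop.comp hNs
  have hmeas := tendsto_natCast_atTop_atTop.eventually
    (hT.rate_lt_measure_smul hB hp hγ hC hCE h0 hvol hsγ)
  filter_upwards [hn.eventually hev, hn.eventually hmeas, hNs.eventually_ge_atTop 2,
    hB.tendsto.eventually_gt_atTop 0, Ioo_mem_nhdsGT (zero_lt_one' ℝ)] with α h1 h2 h3 h4 hα x hx
  set n := ⌊N α ^ (1 / s)⌋₊
  have hle : (n : ℝ) ≤ N α ^ (1 / s) := Nat.floor_le (by linarith)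
  have hge : 1 / 2 * N α ^ (1 / s) ≤ n := by
    have := Nat.lt_floor_add_one (N α ^ (1 / s))
    linarith
  have hn0 : (0 : ℝ) < n := by linarith
  have h6 : a * (1 / 2) ^ r * N α ^ (r / s) ≤ a * (n : ℝ) ^ r := by
    rw [mul_assoc]
    refine mul_le_mul_of_nonneg_left ?_ ha.le
    calc (1 / 2 : ℝ) ^ r * N α ^ (r / s) = (1 / 2 * N α ^ (1 / s)) ^ r := by
          rw [Real.mul_rpow (by norm_num) (by positivity), ← Real.rpow_mul h4.le,
            one_div_mul_eq_div s r]
      _ ≤ (n : ℝ) ^ r := by gcongr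
  refine h6.trans ?_
  by_contra! hlt
  have hsub : (n : ℝ) • C ⊆ {z | ∀ k, g k x z ≤ 0}ᶜ := by
    rintro _ ⟨z, hz, rfl⟩ hsafe
    exact h1 x hx.1 hlt.le z hz (gmax_nonpos_iff.2 hsafe)
  have h7 := (measure_mono hsub).trans ((le_measure_safe_iff hg hα).1 hx.2)
  have h8 : α ≤ B ((n : ℝ) ^ s) := by
    refine hB.le_rate α hα _ (by positivity) ?_
    calc (n : ℝ) ^ s ≤ (N α ^ (1 / s)) ^ s := by gcongr
      _ = N α := by rw [← Real.rpow_mul h4.le, one_div_mul_cancel hs.ne', Real.rpow_one]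
  exact absurd (h7.trans (ENNReal.ofReal_le_ofReal h8)) (not_le.2 h2)

/-- If a family of problems is squeezed between the chance-constrained problems at the levels `α`
and `α ^ (1 + ε)`, for all `ε > 0`, then the logarithm of its optimal value grows like
`(r / γ) log N(α)`. -/
theorem tendsto_log_optimalValue_div [IsProbabilityMeasure P]
    (hg : ∀ k, LowerSemicontinuous fun p : (Fin m → ℝ) × (Fin d → ℝ) => g k p.1 p.2)
    (hX : IsConeSet X) (hX' : (regularDecisions g E X).Nonempty) (hr : 0 < r)
    (hmodel : HomogeneousModel g E X r ∨ AsymptoticModel g E X r)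
    (hc : CostAssumption c X (regularDecisions g E X) r) (hp : HasDensitySupportedOn P p E)
    (hB : TailScale B N) (hγ : 0 < γ) (hT : HasTailRate p E B γ) {A : ℝ → Set (Fin m → ℝ)}
    (hA : ∀ᶠ α in 𝓝[>] (0 : ℝ), A α ⊆ ccpFeasible g X P α)
    (hA' : ∀ ε : ℝ, 0 < ε → ∀ᶠ α in 𝓝[>] (0 : ℝ), ccpFeasible g X P (α ^ (1 + ε)) ⊆ A α) :
    Tendsto (fun α => Real.log (optimalValue c (A α)) / Real.log (N α)) (𝓝[>] 0)
      (𝓝 (r / γ)) := by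
  have hκ : 0 < r / γ := by positivity
  have hlow : ∀ b, 0 < b → b < r / γ → ∃ D > 0, ∀ᶠ α in 𝓝[>] (0 : ℝ),
      ∀ x ∈ A α, D * N α ^ b ≤ c x := by
    intro b hb hbγ
    obtain ⟨D, hD, h⟩ := le_cost_of_mem_ccpFeasible hg hX hX' hr hmodel hc hp hB hγ hT
      (s := r / b) ((lt_div_comm₀ hb hγ).1 hbγ)
    refine ⟨D, hD, ?_⟩
    filter_upwards [h, hA] with α h1 h2 x hx
    have := h1 x (h2 hx)
    rwa [div_div_cancel₀ hr.ne'] at this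
  have hup : ∀ b, r / γ < b → ∃ D > 0, ∀ᶠ α in 𝓝[>] (0 : ℝ), ∃ x ∈ A α, c x ≤ D * N α ^ b := by
    intro b hb
    obtain ⟨b', h1, h2⟩ := exists_between hb
    have hb' : 0 < b' := hκ.trans h1
    obtain ⟨D, hD, h⟩ := exists_ccpFeasible_cost_le hg hX' hr hmodel hc hp hB hT
      (s := r / b') (by positivity) ((div_lt_comm₀ hγ hb').1 h1)
    have hε : 0 < b / b' - 1 := sub_pos.2 ((one_lt_div hb').2 h2)
    have hlim : Tendsto (fun α : ℝ => α ^ (1 + (b / b' - 1))) (𝓝[>] 0) (𝓝[>] 0) := by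
      refine tendsto_nhdsWithin_iff.2 ⟨?_, ?_⟩
      · have := (Real.continuousAt_rpow_const 0 (1 + (b / b' - 1))
          (Or.inr (by linarith))).tendsto
        rw [Real.zero_rpow (by linarith)] at this
        exact this.mono_left nhdsWithin_le_nhds
      · filter_upwards [self_mem_nhdsWithin] with α hα
        exact Real.rpow_pos_of_pos hα _
    refine ⟨D, hD, ?_⟩
    filter_upwards [hlim.eventually h, hA' _ hε, hB.rpow_le _ hε,
      hlim.eventually (hB.tendsto.eventually_gt_atTop 0),
      hB.tendsto.eventually_gt_atTop 0] with α ⟨x, hx, hcx⟩ h3 h4 h5 h6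
    refine ⟨x, h3 hx, hcx.trans ?_⟩
    rw [div_div_cancel₀ hr.ne']
    refine mul_le_mul_of_nonneg_left ?_ hD.le
    calc N (α ^ (1 + (b / b' - 1))) ^ b' ≤ (N α ^ (1 + (b / b' - 1))) ^ b' := by gcongr
      _ = N α ^ b := by
        rw [← Real.rpow_mul h6.le]
        congr 1
        field_simp
        ring
  have hne : ∀ᶠ α in 𝓝[>] (0 : ℝ), (c '' A α).Nonempty := by
    obtain ⟨D, _, h⟩ := hup (r / γ + 1) (by linarith)
    filter_upwards [h] with α ⟨x, hx, _⟩
    exact ⟨_, x, hx, rfl⟩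
  have hge : ∀ b, 0 < b → b < r / γ → ∃ D > 0, ∀ᶠ α in 𝓝[>] (0 : ℝ),
      D * N α ^ b ≤ optimalValue c (A α) := by
    intro b hb hbγ
    obtain ⟨D, hD, h⟩ := hlow b hb hbγ
    refine ⟨D, hD, ?_⟩
    filter_upwards [h, hne] with α h1 h2
    refine le_csInf h2 ?_
    rintro _ ⟨x, hx, rfl⟩
    exact h1 x hx
  have hbdd : ∀ᶠ α in 𝓝[>] (0 : ℝ), BddBelow (c '' A α) := by
    obtain ⟨D, _, h⟩ := hlow (r / γ / 2) (by positivity) (by linarith)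
    filter_upwards [h] with α h1
    refine ⟨D * N α ^ (r / γ / 2), ?_⟩
    rintro _ ⟨x, hx, rfl⟩
    exact h1 x hx
  have hpos : ∀ᶠ α in 𝓝[>] (0 : ℝ), 0 < optimalValue c (A α) := by
    obtain ⟨D, hD, h⟩ := hge (r / γ / 2) (by positivity) (by linarith)
    filter_upwards [h, hB.tendsto.eventually_gt_atTop 0] with α h1 h2
    exact lt_of_lt_of_le (by positivity) h1
  rw [tendsto_order]
  constructor
  · intro b hb
    obtain ⟨b₁, h1, h2⟩ := exists_between (max_lt hb hκ)
    obtain ⟨b₂, h3, h4⟩ := exists_between h2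
    have hb₁ : 0 < b₁ := (le_max_right _ _).trans_lt h1
    obtain ⟨D, hD, h⟩ := hge b₂ (hb₁.trans h3) h4
    filter_upwards [h, hB.tendsto.eventually_gt_atTop 1,
      hB.tendsto.eventually (eventually_const_mul_rpow_le D⁻¹ h3)] with α h5 h6 h7
    have h8 : N α ^ b₁ ≤ optimalValue c (A α) := by
      refine le_trans ?_ h5
      rwa [inv_mul_le_iff₀ hD] at h7
    refine ((le_max_left _ _).trans_lt h1).trans_le ((le_div_iff₀ (Real.log_pos h6)).2 ?_)
    rw [← Real.log_rpow (by linarith)]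
    exact Real.log_le_log (Real.rpow_pos_of_pos (by linarith) _) h8
  · intro b hb
    obtain ⟨b₁, h1, h2⟩ := exists_between hb
    obtain ⟨b₂, h3, h4⟩ := exists_between h2
    obtain ⟨D, hD, h⟩ := hup b₁ h1
    filter_upwards [h, hB.tendsto.eventually_gt_atTop 1, hbdd, hpos,
      hB.tendsto.eventually (eventually_const_mul_rpow_le D h3)] with α ⟨x, hx, h5⟩ h6 h7 h8 h9
    have h10 : optimalValue c (A α) ≤ N α ^ b₂ :=
      (csInf_le h7 ⟨x, hx, rfl⟩).trans (h5.trans h9)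
    refine ((div_le_iff₀ (Real.log_pos h6)).2 ?_).trans_lt h4
    rw [← Real.log_rpow (by linarith)]
    exact Real.log_le_log h8 h10

theorem IsOptimalSolution.eq_optimalValue {A : Set (Fin m → ℝ)} {x : Fin m → ℝ}
    (h : IsOptimalSolution c A x) : optimalValue c A = c x :=
  IsLeast.csInf_eq ⟨⟨x, h.1, rfl⟩, by rintro _ ⟨y, hy, rfl⟩; exact h.2 y hy⟩

theorem tendsto_log_optimalValue_dro_div_ccp [IsProbabilityMeasure P]
    (hg : ∀ k, LowerSemicontinuous fun p : (Fin m → ℝ) × (Fin d → ℝ) => g k p.1 p.2)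
    (hX : IsConeSet X) (hX' : (regularDecisions g E X).Nonempty) (hr : 0 < r)
    (hmodel : HomogeneousModel g E X r ∨ AsymptoticModel g E X r)
    (hc : CostAssumption c X (regularDecisions g E X) r) (hp : HasDensitySupportedOn P p E)
    (hB : TailScale B N) (hγ : 0 < γ) (hT : HasTailRate p E B γ)
    {f : ℝ → ℝ} (hf : f 1 = 0) (hexp : StretchedExponentiallyGrowing f) {η : ℝ} (hη : 0 < η) :
    Tendsto (fun α : ℝ => Real.log (optimalValue c (droFeasible g X (ambiguitySet f η P) α)) /
      Real.log (optimalValue c (ccpFeasible g X P α))) (𝓝[>] 0) (𝓝 1) := by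
  have h1 := tendsto_log_optimalValue_div hg hX hX' hr hmodel hc hp hB hγ hT
    (A := droFeasible g X (ambiguitySet f η P))
    (Eventually.of_forall fun α => droFeasible_subset_ccpFeasible (self_mem_ambiguitySet hf η) α)
    (fun ε hε => eventually_ccpFeasible_subset_droFeasible hg hexp hη hε)
  have h2 := tendsto_log_optimalValue_div hg hX hX' hr hmodel hc hp hB hγ hT
    (A := ccpFeasible g X P) (Eventually.of_forall fun α => Subset.rfl) (fun ε hε => by
      filter_upwards [Ioo_mem_nhdsGT (zero_lt_one' ℝ)] with α hα x hx
      refine ⟨hx.1, le_trans (ENNReal.ofReal_le_ofReal ?_) hx.2⟩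
      have := Real.rpow_le_rpow_of_exponent_ge hα.1 hα.2.le (show 1 ≤ 1 + ε by linarith)
      rw [Real.rpow_one] at this
      linarith)
  have h3 : r / γ ≠ 0 := by positivity
  have h4 := h1.div h2 h3
  rw [div_self h3] at h4
  refine h4.congr' ?_
  filter_upwards [hB.tendsto.eventually_gt_atTop 1] with α hα
  exact div_div_div_cancel_right₀ (Real.log_pos hα).ne' _ _

end

end ChanceDRO

theorem mainTheorem4 {m d K : ℕ}
    (g : Fin K → (Fin m → ℝ) → (Fin d → ℝ) → EReal)
    (hg : ∀ k, LowerSemicontinuous fun p : (Fin m → ℝ) × (Fin d → ℝ) => g k p.1 p.2)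
    (E : Set (Fin d → ℝ)) (X : Set (Fin m → ℝ)) (hX : ChanceDRO.IsConeSet X)
    (hX' : (ChanceDRO.regularDecisions g E X).Nonempty)
    (r : ℝ) (hr : 0 < r)
    (hmodel : ChanceDRO.HomogeneousModel g E X r ∨ ChanceDRO.AsymptoticModel g E X r)
    (c : (Fin m → ℝ) → ℝ)
    (hc : ChanceDRO.CostAssumption c X (ChanceDRO.regularDecisions g E X) r)
    (P : Measure (Fin d → ℝ)) [IsProbabilityMeasure P] (p : (Fin d → ℝ) → ℝ)
    (hp : ChanceDRO.HasDensitySupportedOn P p E)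
    (htail : ChanceDRO.LightTailed p E ∨ ChanceDRO.HeavyTailed p E)
    (f : ℝ → ℝ) (hf : ChanceDRO.DivergenceFunction f)
    (hexp : ChanceDRO.ExponentiallyGrowing f)
    (η : ℝ) (hη : 0 < η) :
    (∀ xf : ℝ → Fin m → ℝ,
      (∀ᶠ α in 𝓝[>] (0 : ℝ), ChanceDRO.IsOptimalSolution c
        (ChanceDRO.droFeasible g X (ChanceDRO.ambiguitySet f η P) α) (xf α)) →
      Tendsto (fun α : ℝ => Real.log (c (xf α)) /
          Real.log (ChanceDRO.optimalValue c (ChanceDRO.ccpFeasible g X P α)))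
        (𝓝[>] 0) (𝓝 1)) ∧
    Tendsto (fun α : ℝ =>
        Real.log (ChanceDRO.optimalValue c
          (ChanceDRO.droFeasible g X (ChanceDRO.ambiguitySet f η P) α)) /
        Real.log (ChanceDRO.optimalValue c (ChanceDRO.ccpFeasible g X P α)))
      (𝓝[>] 0) (𝓝 1) := by
  have hne := ChanceDRO.exists_ne_zero_of_model hX' hmodel
  have hval : Tendsto (fun α : ℝ =>
        Real.log (ChanceDRO.optimalValue c
          (ChanceDRO.droFeasible g X (ChanceDRO.ambiguitySet f η P) α)) /
        Real.log (ChanceDRO.optimalValue c (ChanceDRO.ccpFeasible g X P α)))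
      (𝓝[>] 0) (𝓝 1) := by
    rcases htail with h | h
    · obtain ⟨γ, hγ, hT⟩ := h.hasTailRate hp.nonneg hp.cone hne
      exact ChanceDRO.tendsto_log_optimalValue_dro_div_ccp hg hX hX' hr hmodel hc hp
        ChanceDRO.tailScale_exp hγ hT hf.one hexp.stretched hη
    · obtain ⟨γ, hγ, hT⟩ := h.hasTailRate hp.cone hne
      exact ChanceDRO.tendsto_log_optimalValue_dro_div_ccp hg hX hX' hr hmodel hc hp
        ChanceDRO.tailScale_inv hγ hT hf.one hexp.stretched hη
  refine ⟨fun xf hxf => hval.congr' ?_, hval⟩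
  filter_upwards [hxf] with α hα
  rw [hα.eq_optimalValue]
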